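/- Setting. Let $\Gamma=\mathbb Z^3$, $T^3=\mathbb R^3/\Gamma$, $\Gamma^*=2\pi\mathbb Z^3$, $\Pi^*=[0,2\pi]^3$, and $\tilde\sigma(\xi)=\int_{\mathbb R^3}e^{i\xi x}\sigma(x)\,dx$. Fix $Z>0$ and an ion mass $M>0$. An *ion density* is a real function $\mu\in L^1(\mathbb R^3)\cap L^2(\mathbb R^3)$ with $\int\mu=Z$ and $\mu_{\rm per}(x):=\sum_{n\in\mathbb Z^3}\mu(x-n)\in L^2(T^3)$. For $e>0$ put $\sigma=e\mu$. Ground state. For $\psi\in H^1(T^3)$ let $\rho=\sigma_{\rm per}-e|\psi|^2$ and $U(\psi)=\frac12\int_{T^3}[|\nabla\psi|^2+\rho\,G_{\rm per}\rho]\,dx$, where $G_{\rm per}$ acts on the Fourier mode $e^{2\pi imx}$ as multiplication by $|2\pi m|^{-2}$ for $m\ne0$ and by $0$ for $m=0$. A *real ground state* is a pair $(\psi^0,\omega^0)$ with $\omega^0\in\mathbb R$ and $\psi^0$ a real function that minimizes $U$ over all complex $\psi\in H^1(T^3)$ with $\int_{T^3}|\psi|^2=Z$ and satisfies, with $\rho^0=\sigma_{\rm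 per}-e|\psi^0|^2$ and $\Phi^0=G_{\rm per}\rho^0$, the equation $\omega^0\psi^0=-\frac12\Delta\psi^0-e\Phi^0\psi^0$ on $T^3$ in the sense of distributions. Bloch energy. For $\theta\in\Pi^*\setminus\Gamma^*$ and $Y=(\Psi_1,\Psi_2,Q,P)\in\mathcal V(T^3)=H^1(T^3)\oplus H^1(T^3)\oplus\mathbb C^3\oplus\mathbb C^3$ let $\mathcal E(\theta,Y)$ be the quadratic form $$2\langle\Psi_1,\tilde H^0\Psi_1\rangle+4e^2\langle\psi^0\Psi_1,\tilde G\psi^0\Psi_1\rangle+4\,{\rm Re}\langle\Psi_1,\tilde SQ\rangle+2\langle\Psi_2,\tilde H^0\Psi_2\rangle+\overline Q\cdot\hat T(\theta)Q+M^{-1}|P|^2 .$$ Here $\tilde H^0=-\frac12(\nabla-i\theta)^2-e\Phi^0-\omega^0$; $\tilde G$ multiplies the mode $e^{2\pi imx}$ by $|2\pi m-\theta|^{-2}$; $\tilde SQ=e\psi^0\tilde G\big(e^{i\theta y}\sum_n e^{in\theta}\,\nabla\sigma(y+n)\cdot Q\big)$; and $\hat T(\theta)=\hat T_1(\theta)+\hat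 T_2$ with $$\hat T_1(\theta)=\Sigma(\theta):=\sum_{m\in\mathbb Z^3}\Big[\frac{\xi\otimes\xi}{|\xi|^2}|\tilde\sigma(\xi)|^2\Big]_{\xi=2\pi m-\theta},\qquad \hat T_2=\langle\Phi^0,\nabla\otimes\nabla\sigma\rangle .$$ Conditions. (4.1): $(1+|x|^2)\sigma\in L^2(\mathbb R^3)$ and $(\Delta-1)\sigma\in L^1(\mathbb R^3)$ in the sense of distributions. Wiener condition: the matrix $\Sigma(\theta)$ is positive definite for a.e. $\theta\in\Pi^*\setminus\Gamma^*$. (Hpos2), energy positivity: for a.e. $\theta\in\Pi^*\setminus\Gamma^*$ there is $\varkappa(\theta)>0$ with $\mathcal E(\theta,Y)\ge\varkappa(\theta)\|Y\|^2_{\mathcal V(T^3)}$ for all $Y\in\mathcal V(T^3)$. Lemma 10.1. Let $Z>0$ and $M>0$. (i) There exist an ion density $\mu$, with $\tilde\mu(2\pi m)\ne0$ for some $m\in\mathbb Z^3\setminus0$, and $e_0>0$ such that for every $e\in(0,e_0)$ and $\sigma=e\mu$: condition (4.1) and the Wiener condition hold, a real ground state exists, and for every real ground state the energy positivity (Hpos2)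 fails. (ii) If $\mu$ is any ion density satisfying (4.1) (with $\mu$ in place of $\sigma$) and $\tilde\mu(2\pi m)\ne0$ for some $m\in\mathbb Z^3\setminus0$, then there is $e_0>0$ such that for all $e\in(0,e_0)$, $\sigma=e\mu$, and every real ground state, $Q\cdot\hat T_2Q<0$ for $Q=2\pi m$. -/

import Mathlib

open MeasureTheory

noncomputable section

namespace Crystal

/-- Physical space `ℝ³` (and momentum space) with the Euclidean norm. -/
abbrev E3 : Type := EuclideanSpace ℝ (Fin 3)

/-- The torus `T³ = ℝ³/ℤ³`. -/
abbrev T3 : Type := UnitAddTorus (Fin 3)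

/-- The Lebesgue measure `dx` on `T³`, of total mass one. This is the measure with respect to
which Mathlib's Fourier coefficients `UnitAddTorus.mFourierCoeff` are taken. -/
def torusMeasure : Measure T3 := Measure.pi fun _ => AddCircle.haarAddCircle

/-- The Fourier coefficient `∫_{T³} e^{-2πi m·x} f(x) dx`. -/
def coeff (f : T3 → ℂ) (m : Fin 3 → ℤ) : ℂ := UnitAddTorus.mFourierCoeff f m

/-- The point `2πm` of the dual lattice, as a vector of `ℝ³`. -/
def dualPt (m : Fin 3 → ℤ) : E3 := WithLp.toLp 2 fun i => 2 * Real.pi * (m i : ℝ)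

/-- The dual lattice `Γ* = 2πℤ³`. -/
def dualLattice : Set E3 := Set.range dualPt

/-- The closed Brillouin zone `Π* = [0, 2π]³`. -/
def brillouinZone : Set E3 := {θ | ∀ i, 0 ≤ θ i ∧ θ i ≤ 2 * Real.pi}

/-! ### Ion charge densities -/

/-- The periodization `∑_n σ(x - n)`, `n ∈ ℤ³`, as a function on the torus; `x` is the
representative in `[0,1)³`. -/
def periodization (σ : E3 → ℝ) (t : T3) : ℝ :=
  ∑' n : Fin 3 → ℤ,
    σ (WithLp.toLp 2 fun i => ((AddCircle.equivIco (1 : ℝ) 0 (t i) : ℝ) - (n i : ℝ)))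

/-- The Fourier transform `σ̃(ξ) = ∫ e^{iξ·x} σ(x) dx`. -/
def fourierT (σ : E3 → ℝ) (ξ : E3) : ℂ :=
  ∫ x : E3, Complex.exp (Complex.I * ((inner ℝ ξ x : ℝ) : ℂ)) * (σ x : ℂ)

/-- A density `μ ∈ L²(ℝ³)` with total charge `∫ μ = Z` and with `∑_n μ(x - n) ∈ L²(T³)`. -/
structure IsIonDensity (Z : ℝ) (μ : E3 → ℝ) : Prop where
  memLp : MemLp μ 2 volume
  integrable : Integrable μ volume
  integral_eq : ∫ x, μ x = Z
  periodization_memLp : MemLp (periodization μ) 2 torusMeasure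

/-- The conditions `⟨x⟩² σ ∈ L²(ℝ³)` and `(Δ - 1)σ ∈ L¹(ℝ³)`, where `⟨x⟩² = 1 + |x|²` and the
second one is in the sense of distributions. -/
def DecayCondition (σ : E3 → ℝ) : Prop :=
  MemLp (fun x : E3 => (1 + ‖x‖ ^ 2) * σ x) 2 volume ∧
  ∃ g : E3 → ℝ, Integrable g volume ∧
    ∀ φ : E3 → ℝ, ContDiff ℝ ((⊤ : ℕ∞) : WithTop ℕ∞) φ → HasCompactSupport φ →
      ∫ x, σ x * (Laplacian.laplacian φ x - φ x) = ∫ x, g x * φ x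

/-- The matrix `Σ(θ) = ∑_m [ξ ⊗ ξ / |ξ|² · |σ̃(ξ)|²]` at `ξ = 2πm - θ`. -/
def wienerMatrix (σ : E3 → ℝ) (θ : E3) : Matrix (Fin 3) (Fin 3) ℝ :=
  Matrix.of fun i j => ∑' m : Fin 3 → ℤ,
    (dualPt m - θ) i * (dualPt m - θ) j / ‖dualPt m - θ‖ ^ 2 *
      ‖fourierT σ (dualPt m - θ)‖ ^ 2

/-- The Wiener condition: `Σ(θ)` is positive definite for a.e. `θ ∈ Π* \ Γ*`. -/
def WienerCondition (σ : E3 → ℝ) : Prop :=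
  ∀ᵐ θ : E3 ∂volume, θ ∈ brillouinZone \ dualLattice → (wienerMatrix σ θ).PosDef

/-! ### Ground states -/

/-- The Sobolev space `H¹(T³)`. -/
def MemH1 (f : T3 → ℂ) : Prop :=
  MemLp f 2 torusMeasure ∧
    Summable fun m : Fin 3 → ℤ => (1 + ‖dualPt m‖ ^ 2) * ‖coeff f m‖ ^ 2

/-- The squared norm `∫ (|f|² + |∇f|²)` of `H¹(T³)`. -/
def normH1Sq (f : T3 → ℂ) : ℝ :=
  ∑' m : Fin 3 → ℤ, (1 + ‖dualPt m‖ ^ 2) * ‖coeff f m‖ ^ 2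

/-- The operator `G_per = -Δ_per⁻¹`:
`G_per φ(x) = ∑_{m ≠ 0} |2πm|⁻² φ̂(m) e^{2πi m·x}` (absolutely convergent for `φ ∈ L²(T³)`). -/
def gPer (φ : T3 → ℂ) (t : T3) : ℂ :=
  ∑' m : Fin 3 → ℤ,
    if m = 0 then 0
    else coeff φ m / ((‖dualPt m‖ ^ 2 : ℝ) : ℂ) * UnitAddTorus.mFourier m t

/-- The total charge density `ρ = ∑_n σ(x - n) - e|ψ(x)|²` in the periodic cell. -/
def chargeDensity (e : ℝ) (σ : E3 → ℝ) (ψ : T3 → ℂ) (t : T3) : ℝ :=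
  periodization σ t - e * ‖ψ t‖ ^ 2

/-- The electrostatic potential `Φ = G_per ρ`, a real function since `ρ` is real. -/
def potential (e : ℝ) (σ : E3 → ℝ) (ψ : T3 → ℂ) (t : T3) : ℝ :=
  (gPer (fun s => (chargeDensity e σ ψ s : ℂ)) t).re

/-- The energy per cell `U(ψ) = ½ ∫_{T³} [|∇ψ|² + ρ G_per ρ] dx`. -/
def cellEnergy (e : ℝ) (σ : E3 → ℝ) (ψ : T3 → ℂ) : ℝ :=
  (1 / 2) * ((∑' m : Fin 3 → ℤ, ‖dualPt m‖ ^ 2 * ‖coeff ψ m‖ ^ 2) +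
    ∫ t, chargeDensity e σ ψ t * potential e σ ψ t ∂torusMeasure)

/-- The manifold `{ψ ∈ H¹(T³) : ∫ |ψ|² = Z}` of admissible wave functions. -/
def admissible (Z : ℝ) : Set (T3 → ℂ) :=
  {ψ | MemH1 ψ ∧ ∫ t, ‖ψ t‖ ^ 2 ∂torusMeasure = Z}

/-- `(ψ⁰, ω⁰)`, with the potential `Φ⁰ = G_per ρ⁰`, is a real ground state: `ψ⁰` is a real function
which minimizes the energy per cell over all complex admissible wave functions, and
`ω⁰ ψ⁰ = -½ Δψ⁰ - e Φ⁰ ψ⁰` on `T³` in the sense of distributions (i.e. for the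
Fourier coefficients). -/
structure IsRealGroundState (Z e : ℝ) (σ : E3 → ℝ) (ψ : T3 → ℝ) (ω : ℝ) : Prop where
  mem : (fun t => (ψ t : ℂ)) ∈ admissible Z
  minimal : ∀ φ ∈ admissible Z, cellEnergy e σ (fun t => (ψ t : ℂ)) ≤ cellEnergy e σ φ
  schrodinger : ∀ m : Fin 3 → ℤ,
    (ω : ℂ) * coeff (fun t => (ψ t : ℂ)) m =
      (1 / 2 : ℂ) * ((‖dualPt m‖ ^ 2 : ℝ) : ℂ) * coeff (fun t => (ψ t : ℂ)) m -
        (e : ℂ) * coeff (fun t => (potential e σ (fun s => (ψ s : ℂ)) t : ℂ) * (ψ t : ℂ)) m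

/-! ### The Bloch energy form -/

/-- The form `⟨φ, G̃(θ) χ⟩ = ∑_m conj φ̂(m) χ̂(m) / |2πm - θ|²`, where
`φ̂(m) = a m` and `χ̂(m) = b m` are the Fourier coefficients of `φ` and `χ`. -/
def greenForm (θ : E3) (a b : (Fin 3 → ℤ) → ℂ) : ℂ :=
  ∑' m : Fin 3 → ℤ, star (a m) * b m / ((‖dualPt m - θ‖ ^ 2 : ℝ) : ℂ)

/-- The Fourier coefficients of the Bloch transform
`e^{iθ·y} ∑_n e^{iθ·n} (∇σ)(y + n) · Q`, that is, `∫ e^{-iξ·x} ∇σ(x) · Q dx = i(ξ·Q) σ̃(-ξ)`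
at `ξ = 2πm - θ`. -/
def blochGrad (σ : E3 → ℝ) (θ : E3) (Q : EuclideanSpace ℂ (Fin 3)) (m : Fin 3 → ℤ) : ℂ :=
  Complex.I * (∑ j, (((dualPt m - θ) j : ℝ) : ℂ) * Q j) * fourierT σ (-(dualPt m - θ))

/-- The form `⟨Ψ, H̃⁰(θ) Ψ⟩` on `H¹(T³)` of the Bloch Schrödinger operator
`H̃⁰(θ) = -½ (∇ - iθ)² - e Φ⁰ - ω⁰`. -/
def schrodingerForm (e : ℝ) (σ : E3 → ℝ) (ψ : T3 → ℝ) (ω : ℝ) (θ : E3) (Ψ : T3 → ℂ) : ℝ :=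
  (1 / 2) * (∑' m : Fin 3 → ℤ, ‖dualPt m - θ‖ ^ 2 * ‖coeff Ψ m‖ ^ 2) -
    e * (∫ t, potential e σ (fun s => (ψ s : ℂ)) t * ‖Ψ t‖ ^ 2 ∂torusMeasure) -
    ω * ∫ t, ‖Ψ t‖ ^ 2 ∂torusMeasure

/-- The real matrix `T̂₂ = ⟨Φ⁰, ∇ ⊗ ∇σ⟩`, the pairing over `ℝ³` of the periodic potential
`Φ⁰ = ∑_m Φ̂⁰(m) e^{2πi m·x}` with the distribution `∇ ⊗ ∇σ`, whose Fourier transform is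
`-ξ ⊗ ξ σ̃(ξ)`. -/
def matrixT2 (e : ℝ) (σ : E3 → ℝ) (ψ : T3 → ℝ) : Matrix (Fin 3) (Fin 3) ℝ :=
  Matrix.of fun i j => (∑' m : Fin 3 → ℤ,
    coeff (fun t => (potential e σ (fun s => (ψ s : ℂ)) t : ℂ)) m *
      (-((dualPt m i * dualPt m j : ℝ) : ℂ) * fourierT σ (dualPt m))).re

/-- The matrix `T̂(θ) = T̂₁(θ) + T̂₂`; here `T̂₁(θ) = ∑_m [ξ ⊗ ξ / |ξ|² · |σ̃(ξ)|²]` at `ξ = 2πm - θ`,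
the same expression as `Σ(θ)`. -/
def matrixT (e : ℝ) (σ : E3 → ℝ) (ψ : T3 → ℝ) (θ : E3) : Matrix (Fin 3) (Fin 3) ℝ :=
  wienerMatrix σ θ + matrixT2 e σ ψ

/-- Elements `Y = (Ψ₁, Ψ₂, Q, P)`. -/
structure State where
  Ψ₁ : T3 → ℂ
  Ψ₂ : T3 → ℂ
  Q : EuclideanSpace ℂ (Fin 3)
  P : EuclideanSpace ℂ (Fin 3)

/-- Membership in `𝒱(T³) = H¹(T³) ⊕ H¹(T³) ⊕ ℂ³ ⊕ ℂ³`. -/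
def State.MemV (Y : State) : Prop := MemH1 Y.Ψ₁ ∧ MemH1 Y.Ψ₂

/-- The squared norm of `𝒱(T³)`. -/
def State.normVSq (Y : State) : ℝ :=
  normH1Sq Y.Ψ₁ + normH1Sq Y.Ψ₂ + ‖Y.Q‖ ^ 2 + ‖Y.P‖ ^ 2

/-- The energy `ℰ(θ, Y) = ⟨Y, B̃(θ) Y⟩` for `Y ∈ 𝒱(T³)`, where `B̃(θ)` is the operator matrix
```
  2H̃⁰(θ) + 4e² ψ⁰ G̃(θ) ψ⁰    0         2S̃(θ)   0
  0                            2H̃⁰(θ)    0        0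
  2S̃*(θ)                      0         T̂(θ)    0
  0                            0         0        M⁻¹
```
with `S̃(θ)Q = e ψ⁰ G̃(θ) (∇σ·Q)~(θ)`. -/
def blochEnergy (M e : ℝ) (σ : E3 → ℝ) (ψ : T3 → ℝ) (ω : ℝ) (θ : E3) (Y : State) : ℝ :=
  let a : (Fin 3 → ℤ) → ℂ := coeff fun t => (ψ t : ℂ) * Y.Ψ₁ t
  let b : (Fin 3 → ℤ) → ℂ := blochGrad σ θ Y.Q
  2 * schrodingerForm e σ ψ ω θ Y.Ψ₁ + 4 * e ^ 2 * (greenForm θ a a).re +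
    2 * e * (greenForm θ a b + greenForm θ b a).re +
    2 * schrodingerForm e σ ψ ω θ Y.Ψ₂ +
    (∑ i, ∑ j, star (Y.Q i) * (matrixT e σ ψ θ i j : ℂ) * Y.Q j).re +
    M⁻¹ * ‖Y.P‖ ^ 2

/-- Energy positivity: for a.e. `θ ∈ Π* \ Γ*` there is `ϰ(θ) > 0` with
`ℰ(θ, Y) ≥ ϰ(θ) ‖Y‖²` for all `Y ∈ 𝒱(T³)`. -/
def EnergyPositivity (M e : ℝ) (σ : E3 → ℝ) (ψ : T3 → ℝ) (ω : ℝ) : Prop :=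
  ∀ᵐ θ : E3 ∂volume, θ ∈ brillouinZone \ dualLattice →
    ∃ ϰ : ℝ, 0 < ϰ ∧ ∀ Y : State, Y.MemV → ϰ * Y.normVSq ≤ blochEnergy M e σ ψ ω θ Y

end Crystal

end

namespace Crystal

open UnitAddTorus ComplexConjugate Filter Topology

/-! Everything rests on an expansion of T̂₂ for small charge. The constant √Z is an admissible wave
function without kinetic energy, and its energy is the Coulomb energy of the ions alone, of order
e². A ground state therefore has ∫|∇ψ⁰|² = O(e²), its nonconstant part is O(e) in H¹, and the
nonzero Fourier modes of |ψ⁰|² are O(e) in ℓ². So in Φ⁰ the electrons are negligible against the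
ions, and with ξ = 2πm v · T̂₂v = -e² (∑_{m ≠ 0} (v·ξ)²/|ξ|² |μ̃(ξ)|² + O(e)), of which
`exists_matrixT2_form_le` is the upper bound. If v = 2πm and μ̃(v) ≠ 0, the leading sum is positive;
this is (ii).

For (i), T̂₁(θ) is e² times the same lattice sum shifted by θ, so the two parts of T̂(θ) are of the
same order and have to be compared. Take μ a Gaussian and test in the direction of the first axis at
θ = (0, π, π). The shifted points with ξ₁ = 0 contribute nothing and all others have |ξ|² ≥ 6π²,
whereas the subtracted sum contains ξ = (2π, 0, 0) with |ξ|² = 4π². A wide Gaussian has a narrow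
Fourier transform, so the negative part wins (`exists_wienerMatrix_edgePt_lt`). By continuity the
first diagonal entry of T̂(θ) is negative on an open set of θ, and displacing only the ion along the
first axis violates positivity there.

A real ground state exists by the direct method on Fourier coefficients
(`exists_seqEnergy_minimizer`). The diamagnetic inequality replaces a minimizer by its modulus,
which has the same density, and the Schrödinger equation is the Euler–Lagrange equation
(`first_variation`). -/

instance : IsProbabilityMeasure torusMeasure :=
  inferInstanceAs (IsProbabilityMeasure (Measure.pi fun _ : Fin 3 => AddCircle.haarAddCircle))

instance : torusMeasure.IsAddHaarMeasure :=
  inferInstanceAs (Measure.pi fun _ : Fin 3 => (AddCircle.haarAddCircle (T := 1))).IsAddHaarMeasure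

/-! ### Fourier coefficients on the torus -/

theorem coeff_eq_integral (f : T3 → ℂ) (m : Fin 3 → ℤ) :
    coeff f m = ∫ t, mFourier (-m) t * f t ∂torusMeasure := rfl

theorem coeff_congr_ae {f g : T3 → ℂ} (h : f =ᵐ[torusMeasure] g) : coeff f = coeff g := by
  ext m
  refine integral_congr_ae ?_
  filter_upwards [h] with t ht
  simp [ht]

theorem norm_mFourier_apply (m : Fin 3 → ℤ) (t : T3) : ‖mFourier m t‖ = 1 := by
  simp only [mFourier, ContinuousMap.coe_mk, norm_prod, fourier_apply, Circle.norm_coe,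
    Finset.prod_const_one]

theorem integrable_mFourier_mul {f : T3 → ℂ} (hf : Integrable f torusMeasure) (m : Fin 3 → ℤ) :
    Integrable (fun t => mFourier m t * f t) torusMeasure :=
  hf.bdd_mul (c := 1) (mFourier m).continuous.aestronglyMeasurable
    (Eventually.of_forall fun t => (norm_mFourier_apply m t).le)

theorem memLp_mFourier_mul {f : T3 → ℂ} (hf : MemLp f 2 torusMeasure) (m : Fin 3 → ℤ) :
    MemLp (fun t => mFourier m t * f t) 2 torusMeasure :=
  hf.of_le ((mFourier m).continuous.aestronglyMeasurable.mul hf.1)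
    (Eventually.of_forall fun t => by simp [norm_mFourier_apply])

theorem coeff_mFourier_mul (f : T3 → ℂ) (k m : Fin 3 → ℤ) :
    coeff (fun t => mFourier k t * f t) m = coeff f (m - k) := by
  simp only [coeff_eq_integral]
  refine integral_congr_ae (Eventually.of_forall fun t => ?_)
  simp only [← mul_assoc, ← mFourier_add]
  congr 3
  abel

theorem coeff_conj (f : T3 → ℂ) (m : Fin 3 → ℤ) :
    coeff (fun t => conj (f t)) m = conj (coeff f (-m)) := by
  simp only [coeff_eq_integral, ← integral_conj, map_mul, ← mFourier_neg, neg_neg]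

theorem coeff_sub {f g : T3 → ℂ} (hf : Integrable f torusMeasure) (hg : Integrable g torusMeasure)
    (m : Fin 3 → ℤ) : coeff (fun t => f t - g t) m = coeff f m - coeff g m := by
  simp only [coeff_eq_integral, mul_sub]
  exact integral_sub (integrable_mFourier_mul hf _) (integrable_mFourier_mul hg _)

theorem coeff_const_mul (c : ℂ) (f : T3 → ℂ) (m : Fin 3 → ℤ) :
    coeff (fun t => c * f t) m = c * coeff f m := by
  simp only [coeff_eq_integral, ← integral_const_mul]
  congr 1 with t
  ring

theorem coeff_zero_fun : coeff (fun _ => 0) = 0 := by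
  ext m
  simp [coeff_eq_integral]

theorem hasSum_conj_coeff_mul_coeff {f g : T3 → ℂ} (hf : MemLp f 2 torusMeasure)
    (hg : MemLp g 2 torusMeasure) :
    HasSum (fun m => conj (coeff f m) * coeff g m) (∫ t, conj (f t) * g t ∂torusMeasure) := by
  have h := hasSum_prod_mFourierCoeff (d := Fin 3) (hf.toLp f) (hg.toLp g)
  have hf' : coeff (hf.toLp f) = coeff f := coeff_congr_ae hf.coeFn_toLp
  have hg' : coeff (hg.toLp g) = coeff g := coeff_congr_ae hg.coeFn_toLp
  rw [← hf', ← hg']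
  have e : ∫ t, conj (f t) * g t ∂torusMeasure
      = ∫ t, conj (hf.toLp f t) * hg.toLp g t ∂torusMeasure := by
    refine integral_congr_ae ?_
    filter_upwards [hf.coeFn_toLp, hg.coeFn_toLp] with t h1 h2
    rw [h1, h2]
  rw [e]
  exact h

theorem hasSum_norm_sq_coeff {f : T3 → ℂ} (hf : MemLp f 2 torusMeasure) :
    HasSum (fun m => ‖coeff f m‖ ^ 2) (∫ t, ‖f t‖ ^ 2 ∂torusMeasure) := by
  have h := hasSum_sq_mFourierCoeff (d := Fin 3) (hf.toLp f)
  have hf' : coeff (hf.toLp f) = coeff f := coeff_congr_ae hf.coeFn_toLp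
  rw [← hf']
  have e : ∫ t, ‖f t‖ ^ 2 ∂torusMeasure = ∫ t, ‖hf.toLp f t‖ ^ 2 ∂torusMeasure := by
    refine integral_congr_ae ?_
    filter_upwards [hf.coeFn_toLp] with t h1
    rw [h1]
  rw [e]
  exact h

/-- Riesz–Fischer. It turns sequences built as minimizers or competitors back into functions. -/
theorem exists_memLp_coeff_eq {a : (Fin 3 → ℤ) → ℂ} (ha : Summable fun m => ‖a m‖ ^ 2) :
    ∃ f : T3 → ℂ, MemLp f 2 torusMeasure ∧ coeff f = a := by
  have hm : Memℓp a 2 := memℓp_gen (by simpa using ha)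
  let F := (mFourierBasis (d := Fin 3)).repr.symm ⟨a, hm⟩
  refine ⟨F, Lp.memLp F, ?_⟩
  ext m
  have := mFourierBasis_repr (d := Fin 3) F m
  rw [show coeff F m = mFourierCoeff F m from rfl, ← this]
  simp [F]

/-- The Fourier coefficients of a product of square integrable functions. -/
theorem hasSum_coeff_mul_conj {f g : T3 → ℂ} (hf : MemLp f 2 torusMeasure)
    (hg : MemLp g 2 torusMeasure) (m : Fin 3 → ℤ) :
    HasSum (fun k => coeff f (k + m) * conj (coeff g k)) (coeff (fun t => f t * conj (g t)) m) := by
  have h := hasSum_conj_coeff_mul_coeff hg (memLp_mFourier_mul hf (-m))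
  simp only [coeff_mFourier_mul, sub_neg_eq_add] at h
  have e : coeff (fun t => f t * conj (g t)) m
      = ∫ t, conj (g t) * (mFourier (-m) t * f t) ∂torusMeasure := by
    rw [coeff_eq_integral]
    congr 1 with t
    ring
  rw [e]
  simpa only [mul_comm] using h

theorem coeff_mFourier (k m : Fin 3 → ℤ) :
    coeff (fun t => mFourier k t) m = if m = k then 1 else 0 := by
  have h1 : coeff (fun t => mFourier k t) m = coeff (fun t => mFourier k t * 1) m := by simp
  rw [h1, coeff_mFourier_mul, coeff_eq_integral]
  have h := (orthonormal_iff_ite.mp (orthonormal_mFourier (d := Fin 3))) (m - k) 0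
  rw [ContinuousMap.inner_toLp] at h
  have e : ∫ t, mFourier (-(m - k)) t * 1 ∂torusMeasure
     = ∫ t, mFourier (0 : Fin 3 → ℤ) t * conj (mFourier (m - k) t) ∂torusMeasure := by
    refine integral_congr_ae (Eventually.of_forall fun t => ?_)
    simp only [← mFourier_neg, ← mFourier_add]
    simp
  rw [e]
  have h' : ∫ t, mFourier (0 : Fin 3 → ℤ) t * conj (mFourier (m - k) t) ∂torusMeasure
    = if m - k = 0 then 1 else 0 := h
  rw [h']
  simp [sub_eq_zero]

theorem coeff_comp_add (f : T3 → ℂ) (h : T3) (m : Fin 3 → ℤ) :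
    coeff (fun t => f (t + h)) m = mFourier m h * coeff f m := by
  have hm : ∀ t, mFourier (-m) t = mFourier m h * mFourier (-m) (t + h) := by
    intro t
    have h1 : mFourier (-m) (t + h) = mFourier (-m) t * mFourier (-m) h := by
      simp [mFourier, fourier_apply, smul_add, AddCircle.toCircle_add, Finset.prod_mul_distrib]
    have h2 : mFourier m h * mFourier (-m) h = 1 := by
      rw [← mFourier_add]; simp [mFourier_zero]
    rw [h1, mul_left_comm, h2, mul_one]
  simp only [coeff_eq_integral]
  rw [← integral_const_mul]
  rw [← integral_add_right_eq_self (μ := torusMeasure)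
    (fun t => mFourier m h * (mFourier (-m) t * f t)) h]
  refine integral_congr_ae (Eventually.of_forall fun t => ?_)
  simp only [hm t]
  ring

/-- The sum of an absolutely convergent Fourier series. -/
noncomputable def fourierSeries (a : (Fin 3 → ℤ) → ℂ) (t : T3) : ℂ := ∑' m, a m * mFourier m t

/-- Absolute summability of `a` permits exchanging sum and integral while `g` is merely integrable,
as the charge density is. -/
theorem hasSum_coeff_fourierSeries_mul {a : (Fin 3 → ℤ) → ℂ} (ha : Summable fun m => ‖a m‖)
    {g : T3 → ℂ} (hg : Integrable g torusMeasure) (m : Fin 3 → ℤ) :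
    HasSum (fun k => a k * coeff g (m - k)) (coeff (fun t => fourierSeries a t * g t) m) := by
  have h := hasSum_integral_of_summable_integral_norm (μ := torusMeasure)
    (F := fun k t => mFourier (-m) t * (a k * mFourier k t * g t)) (fun k => ?_) ?_
  · have e1 : ∀ k, ∫ t, mFourier (-m) t * (a k * mFourier k t * g t) ∂torusMeasure
        = a k * coeff g (m - k) := by
      intro k
      rw [← coeff_mFourier_mul, ← coeff_const_mul, coeff_eq_integral]
      congr 1 with t
      ring
    have e2 : ∫ t, ∑' k, mFourier (-m) t * (a k * mFourier k t * g t) ∂torusMeasure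
        = coeff (fun t => fourierSeries a t * g t) m := by
      rw [coeff_eq_integral]
      congr 1 with t
      rw [tsum_mul_left, tsum_mul_right]
      rfl
    simpa only [e1, e2] using h
  · refine integrable_mFourier_mul ?_ _
    simp only [mul_assoc]
    exact (integrable_mFourier_mul hg k).const_mul _
  · simp only [norm_mul, norm_mFourier_apply, one_mul, mul_one]
    simp only [integral_const_mul]
    exact ha.mul_right _

theorem coeff_fourierSeries {a : (Fin 3 → ℤ) → ℂ} (ha : Summable fun m => ‖a m‖) :
    coeff (fourierSeries a) = a := by
  ext m
  have h := hasSum_coeff_fourierSeries_mul ha (g := fun t => mFourier 0 t)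
    ((mFourier 0).continuous.integrable_of_hasCompactSupport
      (HasCompactSupport.of_compactSpace _)) m
  simp only [coeff_mFourier, sub_eq_zero] at h
  have h2 : HasSum (fun k => a k * if m = k then 1 else 0) (a m) := by
    convert hasSum_ite_eq m (a m) using 2 with k
    by_cases hk : k = m
    · simp [hk]
    · simp [hk, Ne.symm hk]
  have := h.unique h2
  simpa [mFourier_zero] using this

/-! ### The dual lattice, the Sobolev weight and ℓ² inequalities -/

theorem norm_dualPt_sq (m : Fin 3 → ℤ) :
    ‖dualPt m‖ ^ 2 = (2 * Real.pi) ^ 2 * ∑ i, (m i : ℝ) ^ 2 := by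
  rw [EuclideanSpace.real_norm_sq_eq, Finset.mul_sum]
  simp [dualPt, mul_pow]

theorem dualPt_neg (m : Fin 3 → ℤ) : dualPt (-m) = -dualPt m := by
  ext i; simp [dualPt]

@[simp] theorem dualPt_zero : dualPt 0 = 0 := by
  ext i; simp [dualPt]

theorem sum_sq_le_norm_dualPt_sq (m : Fin 3 → ℤ) : ∑ i, (m i : ℝ) ^ 2 ≤ ‖dualPt m‖ ^ 2 := by
  rw [norm_dualPt_sq]
  have h1 : (1 : ℝ) ≤ (2 * Real.pi) ^ 2 := by nlinarith [Real.pi_gt_three]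
  have h2 : 0 ≤ ∑ i, (m i : ℝ) ^ 2 := Finset.sum_nonneg fun i _ => sq_nonneg _
  nlinarith

theorem one_le_norm_dualPt_sq {m : Fin 3 → ℤ} (hm : m ≠ 0) : 1 ≤ ‖dualPt m‖ ^ 2 := by
  obtain ⟨i, hi⟩ := Function.ne_iff.mp hm
  refine le_trans ?_ (sum_sq_le_norm_dualPt_sq m)
  refine le_trans ?_ (Finset.single_le_sum (fun i _ => sq_nonneg (m i : ℝ)) (Finset.mem_univ i))
  have : (1 : ℤ) ≤ (m i) ^ 2 := by
    have : 0 < (m i) ^ 2 := by simpa using! sq_pos_of_ne_zero hi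
    omega
  exact_mod_cast this

/-- Every finite set of multi-indices lies in a box, over which the sum of products is a product of
sums. -/
theorem summable_pi_prod {ι κ : Type*} [Fintype ι] [DecidableEq ι] [DecidableEq κ] {f : κ → ℝ}
    (hf : Summable f) (h0 : ∀ k, 0 ≤ f k) : Summable fun m : ι → κ => ∏ i, f (m i) := by
  refine summable_of_sum_le (c := (∑' k, f k) ^ Fintype.card ι)
    (fun m => Finset.prod_nonneg fun i _ => h0 _) fun s => ?_
  let t : Finset κ := s.biUnion fun m => Finset.univ.image m
  calc ∑ m ∈ s, ∏ i, f (m i) ≤ ∑ m ∈ Fintype.piFinset fun _ : ι => t, ∏ i, f (m i) := by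
        refine Finset.sum_le_sum_of_subset_of_nonneg ?_
          fun m _ _ => Finset.prod_nonneg fun i _ => h0 _
        intro m hm
        rw [Fintype.mem_piFinset]
        intro i
        exact Finset.mem_biUnion.2 ⟨m, hm, Finset.mem_image_of_mem _ (Finset.mem_univ i)⟩
    _ = ∏ i : ι, ∑ k ∈ t, f k := (Finset.prod_univ_sum (fun _ => t) fun _ k => f k).symm
    _ ≤ ∏ i : ι, ∑' k, f k := Finset.prod_le_prod (fun i _ => Finset.sum_nonneg fun k _ => h0 k)
        fun i _ => hf.sum_le_tsum _ fun k _ => h0 k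
    _ = _ := by simp

/-- The weight `1 + |2πm|²` of `H¹(T³)`. -/
noncomputable def weight (m : Fin 3 → ℤ) : ℝ := 1 + ‖dualPt m‖ ^ 2

theorem one_le_weight (m : Fin 3 → ℤ) : 1 ≤ weight m := by
  simp only [weight, le_add_iff_nonneg_right]; positivity

theorem weight_pos (m : Fin 3 → ℤ) : 0 < weight m := zero_lt_one.trans_le (one_le_weight m)

theorem weight_nonneg (m : Fin 3 → ℤ) : 0 ≤ weight m := (weight_pos m).le

/-- The weight dominates each 1 + mᵢ², so weight⁻² splits into three factors weight^(-2/3), one per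
coordinate. Each is controlled by |mᵢ|^(-4/3), which is summable over ℤ. This is where dimension
three enters. -/
theorem summable_inv_weight_sq : Summable fun m => (weight m)⁻¹ ^ 2 := by
  have h1 : Summable fun k : ℤ => (1 + (k : ℝ) ^ 2) ^ (-(2 / 3) : ℝ) := by
    have h2 : Summable fun k : ℤ => |(k : ℝ)| ^ (-(4 / 3) : ℝ) :=
      Real.summable_abs_int_rpow (by norm_num)
    refine Summable.of_norm_bounded_eventually h2 ?_
    refine (Set.finite_singleton (0 : ℤ)).subset ?_
    intro k hk
    by_contra h0
    apply hk
    have hk1 : (k : ℝ) ≠ 0 := by exact_mod_cast h0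
    have hk0 : (0 : ℝ) < |(k : ℝ)| := abs_pos.2 hk1
    change ‖_‖ ≤ _
    rw [Real.norm_of_nonneg (by positivity)]
    have : |(k : ℝ)| ^ (-(4 / 3) : ℝ) = ((k : ℝ) ^ 2) ^ (-(2 / 3) : ℝ) := by
      rw [← sq_abs, ← Real.rpow_natCast, ← Real.rpow_mul hk0.le]
      norm_num
    rw [this]
    exact Real.rpow_le_rpow_of_nonpos (by positivity) (by linarith) (by norm_num)
  refine (summable_pi_prod (ι := Fin 3) h1 fun k => by positivity).of_nonneg_of_le
    (fun m => by positivity) fun m => ?_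
  have hw : ∀ i, 1 + (m i : ℝ) ^ 2 ≤ weight m := fun i => by
    unfold weight
    have := Finset.single_le_sum (fun i _ => sq_nonneg (m i : ℝ)) (Finset.mem_univ i)
    linarith [sum_sq_le_norm_dualPt_sq m]
  calc (weight m)⁻¹ ^ 2 = ∏ _i : Fin 3, weight m ^ (-(2 / 3) : ℝ) := by
        rw [Finset.prod_const, Finset.card_univ, Fintype.card_fin, ← Real.rpow_natCast,
          ← Real.rpow_natCast, ← Real.rpow_mul (weight_nonneg m), Real.inv_rpow (weight_nonneg m),
          ← Real.rpow_neg (weight_nonneg m)]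
        norm_num
    _ ≤ _ := Finset.prod_le_prod (fun i _ => Real.rpow_nonneg (weight_nonneg m) _) fun i _ =>
        Real.rpow_le_rpow_of_nonpos (by positivity) (hw i) (by norm_num)

theorem tendsto_inv_weight : Tendsto (fun m => (weight m)⁻¹) cofinite (𝓝 0) := by
  have := summable_inv_weight_sq.tendsto_cofinite_zero
  have h := this.sqrt
  simpa only [Real.sqrt_sq (inv_nonneg.2 (weight_nonneg _)), Real.sqrt_zero] using h

theorem summable_shift {f : (Fin 3 → ℤ) → ℝ} (hf : Summable f) (m : Fin 3 → ℤ) :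
    Summable fun k => f (k + m) :=
  hf.comp_injective (add_left_injective m)

theorem tsum_shift (f : (Fin 3 → ℤ) → ℝ) (m : Fin 3 → ℤ) : ∑' k, f (k + m) = ∑' k, f k :=
  Equiv.tsum_eq (Equiv.addRight m) f

theorem summable_mul_of_sq {ι : Type*} {f g : ι → ℝ} (hf : Summable fun k => f k ^ 2)
    (hg : Summable fun k => g k ^ 2) : Summable fun k => f k * g k := by
  refine Summable.of_norm_bounded (hf.add hg) fun k => ?_
  rw [Real.norm_eq_abs, abs_le]
  constructor <;> nlinarith [sq_nonneg (f k + g k), sq_nonneg (f k - g k)]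

/-- The Cauchy–Schwarz inequality for square summable families. -/
theorem tsum_mul_sq_le {ι : Type*} {f g : ι → ℝ} (hf : Summable fun k => f k ^ 2)
    (hg : Summable fun k => g k ^ 2) :
    (∑' k, f k * g k) ^ 2 ≤ (∑' k, f k ^ 2) * ∑' k, g k ^ 2 := by
  have h : Tendsto (fun s : Finset ι => (∑ k ∈ s, f k * g k) ^ 2) atTop
      (𝓝 ((∑' k, f k * g k) ^ 2)) := ((summable_mul_of_sq hf hg).hasSum).pow 2
  refine le_of_tendsto' h fun s => (Finset.sum_mul_sq_le_sq_mul_sq s f g).trans ?_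
  exact mul_le_mul (hf.sum_le_tsum s fun _ _ => sq_nonneg _)
    (hg.sum_le_tsum s fun _ _ => sq_nonneg _) (Finset.sum_nonneg fun _ _ => sq_nonneg _)
    (tsum_nonneg fun _ => sq_nonneg _)

/-! ### The space H¹ and products of its elements, on Fourier coefficients -/

/-- The sequences of Fourier coefficients of elements of `H¹(T³)`. -/
def H1Seq (a : (Fin 3 → ℤ) → ℂ) : Prop := Summable fun m => weight m * ‖a m‖ ^ 2

/-- The squared norm of `H¹(T³)`, on Fourier coefficients. -/
noncomputable def h1Sq (a : (Fin 3 → ℤ) → ℂ) : ℝ := ∑' m, weight m * ‖a m‖ ^ 2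

theorem h1Sq_nonneg (a : (Fin 3 → ℤ) → ℂ) : 0 ≤ h1Sq a :=
  tsum_nonneg fun m => mul_nonneg (weight_nonneg m) (sq_nonneg _)

theorem H1Seq.summable_sq {a : (Fin 3 → ℤ) → ℂ} (ha : H1Seq a) : Summable fun m => ‖a m‖ ^ 2 :=
  Summable.of_nonneg_of_le (fun _ => sq_nonneg _)
    (fun m => le_mul_of_one_le_left (sq_nonneg _) (one_le_weight m)) ha

theorem H1Seq.summable_norm_dualPt_sq {a : (Fin 3 → ℤ) → ℂ} (ha : H1Seq a) :
    Summable fun m => ‖dualPt m‖ ^ 2 * ‖a m‖ ^ 2 :=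
  Summable.of_nonneg_of_le (fun m => by positivity)
    (fun m => mul_le_mul_of_nonneg_right (by simp [weight]) (sq_nonneg _)) ha

theorem H1Seq.h1Sq_eq {a : (Fin 3 → ℤ) → ℂ} (ha : H1Seq a) :
    h1Sq a = (∑' m, ‖a m‖ ^ 2) + ∑' m, ‖dualPt m‖ ^ 2 * ‖a m‖ ^ 2 := by
  rw [← ha.summable_sq.tsum_add ha.summable_norm_dualPt_sq]
  simp only [h1Sq, weight, add_mul, one_mul]

theorem summable_norm_mul_shift {a b : (Fin 3 → ℤ) → ℂ} (ha : Summable fun m => ‖a m‖ ^ 2)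
    (hb : Summable fun m => ‖b m‖ ^ 2) (m : Fin 3 → ℤ) :
    Summable fun k => ‖a (k + m)‖ * ‖b k‖ :=
  summable_mul_of_sq (summable_shift ha m) hb

/-- The constant `∑_m (1 + |2πm|²)⁻²`. -/
noncomputable def weightConst : ℝ := ∑' m, (weight m)⁻¹ ^ 2

theorem weightConst_nonneg : 0 ≤ weightConst := tsum_nonneg fun _ => sq_nonneg _

/-- The Sobolev-type bound which shows that products of elements of `H¹(T³)` are in `L²(T³)`. -/
theorem H1Seq.corr_bound {a b : (Fin 3 → ℤ) → ℂ} (ha : H1Seq a) (hb : H1Seq b) :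
    (Summable fun m => (∑' k, ‖a (k + m)‖ * ‖b k‖) ^ 2) ∧
      ∑' m, (∑' k, ‖a (k + m)‖ * ‖b k‖) ^ 2 ≤ weightConst * (h1Sq a * h1Sq b) := by
  have hprod : Summable fun x : (Fin 3 → ℤ) × (Fin 3 → ℤ) =>
      (weight x.1 * ‖a x.1‖ ^ 2) * (weight x.2 * ‖b x.2‖ ^ 2) :=
    Summable.mul_of_nonneg ha hb (fun m => mul_nonneg (weight_nonneg m) (sq_nonneg _))
      fun m => mul_nonneg (weight_nonneg m) (sq_nonneg _)
  -- The shear (m, k) ↦ (k + m, k), which reduces the sum of `F` to a product of two H¹ norms.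
  let E : (Fin 3 → ℤ) × (Fin 3 → ℤ) ≃ (Fin 3 → ℤ) × (Fin 3 → ℤ) :=
    (Equiv.prodComm _ _).trans (Equiv.prodShear (Equiv.refl _) fun k => Equiv.addLeft k) |>.trans
      (Equiv.prodComm _ _)
  let F : (Fin 3 → ℤ) × (Fin 3 → ℤ) → ℝ := fun x =>
      (weight (x.2 + x.1) * ‖a (x.2 + x.1)‖ ^ 2) * (weight x.2 * ‖b x.2‖ ^ 2)
  let P : (Fin 3 → ℤ) × (Fin 3 → ℤ) → ℝ := fun x =>
      (weight x.1 * ‖a x.1‖ ^ 2) * (weight x.2 * ‖b x.2‖ ^ 2)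
  have hFE : F = P ∘ E := rfl
  have hF : Summable F := by
    rw [hFE]
    exact E.summable_iff.2 hprod
  have hFsum : ∑' x, F x = h1Sq a * h1Sq b := by
    have h1 : ∑' x, F x = ∑' x, P x := by
      rw [hFE]
      exact E.tsum_eq P
    rw [h1]
    exact (Summable.tsum_mul_tsum ha hb hprod).symm
  -- The weights at k + m and k are decoupled by 2xy ≤ x² + y², so the bound is uniform in m.
  have hG : ∀ m, Summable (fun k => (√(weight (k + m))⁻¹ * √(weight k)⁻¹) ^ 2) ∧
      ∑' k, (√(weight (k + m))⁻¹ * √(weight k)⁻¹) ^ 2 ≤ weightConst := by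
    intro m
    have h1 : Summable fun k => (weight (k + m))⁻¹ ^ 2 :=
      summable_shift summable_inv_weight_sq m
    have h1s : ∑' k, (weight (k + m))⁻¹ ^ 2 = weightConst :=
      tsum_shift (fun k => (weight k)⁻¹ ^ 2) m
    have h2 : ∀ k, (√(weight (k + m))⁻¹ * √(weight k)⁻¹) ^ 2
        ≤ 1 / 2 * ((weight (k + m))⁻¹ ^ 2 + (weight k)⁻¹ ^ 2) := by
      intro k
      rw [mul_pow, Real.sq_sqrt (inv_nonneg.2 (weight_nonneg _)),
        Real.sq_sqrt (inv_nonneg.2 (weight_nonneg _))]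
      nlinarith [sq_nonneg ((weight (k + m))⁻¹ - (weight k)⁻¹)]
    have h3 := (h1.add summable_inv_weight_sq).mul_left (1 / 2)
    have h4 := Summable.of_nonneg_of_le (fun k => sq_nonneg _) h2 h3
    refine ⟨h4, (h4.tsum_le_tsum h2 h3).trans_eq ?_⟩
    rw [tsum_mul_left, h1.tsum_add summable_inv_weight_sq, h1s]
    change 1 / 2 * (weightConst + weightConst) = weightConst
    ring
  -- Cauchy–Schwarz after inserting the square roots of the two weights and of their inverses.
  have key : ∀ m, (∑' k, ‖a (k + m)‖ * ‖b k‖) ^ 2 ≤ weightConst * ∑' k, F (m, k) := by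
    intro m
    have e1 : ∀ k, ‖a (k + m)‖ * ‖b k‖ = √(F (m, k)) * (√(weight (k + m))⁻¹ * √(weight k)⁻¹) := by
      intro k
      have p1 := weight_pos (k + m)
      have p2 := weight_pos k
      simp only [F]
      rw [Real.sqrt_mul (by positivity), Real.sqrt_mul (by positivity), Real.sqrt_mul p2.le,
        Real.sqrt_sq (norm_nonneg _), Real.sqrt_sq (norm_nonneg _), Real.sqrt_inv, Real.sqrt_inv]
      have := Real.sqrt_pos.2 p1
      have := Real.sqrt_pos.2 p2
      field_simp
    have e2 : ∀ k, √(F (m, k)) ^ 2 = F (m, k) := fun k =>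
      Real.sq_sqrt (mul_nonneg (mul_nonneg (weight_nonneg _) (sq_nonneg _))
        (mul_nonneg (weight_nonneg _) (sq_nonneg _)))
    have hs : Summable fun k => √(F (m, k)) ^ 2 := by
      simp only [e2]
      exact hF.prod_factor m
    have := tsum_mul_sq_le hs (hG m).1
    simp only [← e1, e2] at this
    refine this.trans ?_
    rw [mul_comm]
    refine mul_le_mul_of_nonneg_right (hG m).2 (tsum_nonneg fun k => ?_)
    rw [← e2]
    positivity
  have hs2 := (hF.prod).mul_left weightConst
  have hs3 := Summable.of_nonneg_of_le (fun m => sq_nonneg _) key hs2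
  refine ⟨hs3, (hs3.tsum_le_tsum key hs2).trans_eq ?_⟩
  rw [tsum_mul_left, ← hFsum, hF.tsum_prod]

theorem MemH1.h1Seq {f : T3 → ℂ} (hf : MemH1 f) : H1Seq (coeff f) := hf.2

theorem MemH1.integrable_sq {f : T3 → ℂ} (hf : MemH1 f) :
    Integrable (fun t => ‖f t‖ ^ 2) torusMeasure := (memLp_two_iff_integrable_sq_norm hf.1.1).1 hf.1

/-- The correlation `∑_k a(k+m) conj (a k)`: the Fourier coefficients of `|ψ|²` if `a` are those
of `ψ`. -/
noncomputable def corr (a : (Fin 3 → ℤ) → ℂ) (m : Fin 3 → ℤ) : ℂ := ∑' k, a (k + m) * conj (a k)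

theorem coeff_norm_sq {f : T3 → ℂ} (hf : MemLp f 2 torusMeasure) :
    coeff (fun t => ((‖f t‖ ^ 2 : ℝ) : ℂ)) = corr (coeff f) := by
  ext m
  have h : (fun t => ((‖f t‖ ^ 2 : ℝ) : ℂ)) = fun t => f t * conj (f t) := by
    ext t
    rw [Complex.mul_conj, Complex.normSq_eq_norm_sq]
  rw [h]
  exact ((hasSum_coeff_mul_conj hf hf m).tsum_eq).symm

theorem norm_corr_le {a : (Fin 3 → ℤ) → ℂ} (ha : H1Seq a) (m : Fin 3 → ℤ) :
    ‖corr a m‖ ≤ ∑' k, ‖a (k + m)‖ * ‖a k‖ := by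
  have := summable_norm_mul_shift ha.summable_sq ha.summable_sq m
  exact tsum_of_norm_bounded this.hasSum fun k => by simp

theorem H1Seq.summable_corr_sq {a : (Fin 3 → ℤ) → ℂ} (ha : H1Seq a) :
    Summable fun m => ‖corr a m‖ ^ 2 :=
  Summable.of_nonneg_of_le (fun _ => sq_nonneg _)
    (fun m => by gcongr; exact norm_corr_le ha m) (ha.corr_bound ha).1

/-! ### The Coulomb potential and the energy per cell on Fourier coefficients -/

theorem inv_norm_dualPt_sq_le (m : Fin 3 → ℤ) : (‖dualPt m‖ ^ 2)⁻¹ ≤ 2 * (weight m)⁻¹ := by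
  by_cases hm : m = 0
  · simp [hm, weight]
  · have := one_le_norm_dualPt_sq hm
    rw [← div_eq_mul_inv, le_div_iff₀ (weight_pos m), inv_mul_le_iff₀ (by positivity)]
    unfold weight
    linarith

theorem inv_norm_dualPt_sq_le_one (m : Fin 3 → ℤ) : (‖dualPt m‖ ^ 2)⁻¹ ≤ 1 := by
  by_cases hm : m = 0
  · simp [hm]
  · exact inv_le_one_of_one_le₀ (one_le_norm_dualPt_sq hm)

theorem summable_norm_div_norm_dualPt_sq {b : (Fin 3 → ℤ) → ℂ} (hb : Summable fun m => ‖b m‖ ^ 2) :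
    Summable fun m => ‖b m / ((‖dualPt m‖ ^ 2 : ℝ) : ℂ)‖ := by
  refine Summable.of_nonneg_of_le (fun _ => norm_nonneg _) (fun m => ?_)
    ((summable_mul_of_sq hb summable_inv_weight_sq).mul_left 2)
  rw [norm_div, Complex.norm_real, Real.norm_of_nonneg (by positivity), div_eq_mul_inv,
    mul_left_comm]
  exact mul_le_mul_of_nonneg_left (inv_norm_dualPt_sq_le m) (norm_nonneg _)

/-- Since x / 0 = 0, dividing by |2πm|² already removes the mode m = 0, and the case distinction can
be dropped. All later Coulomb sums rely on this convention. -/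
theorem gPer_eq_fourierSeries (f : T3 → ℂ) :
    gPer f = fourierSeries fun m => coeff f m / ((‖dualPt m‖ ^ 2 : ℝ) : ℂ) := by
  ext t
  refine tsum_congr fun m => ?_
  by_cases hm : m = 0 <;> simp [hm]

theorem coeff_ofReal_neg (g : T3 → ℝ) (m : Fin 3 → ℤ) :
    coeff (fun t => (g t : ℂ)) (-m) = conj (coeff (fun t => (g t : ℂ)) m) := by
  have := coeff_conj (fun t => (g t : ℂ)) (-m)
  simpa using this

theorem norm_dualPt_neg (m : Fin 3 → ℤ) : ‖dualPt (-m)‖ = ‖dualPt m‖ := by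
  rw [dualPt_neg, norm_neg]

theorem ofReal_re_gPer (g : T3 → ℝ) (t : T3) :
    ((gPer (fun s => (g s : ℂ)) t).re : ℂ) = gPer (fun s => (g s : ℂ)) t := by
  rw [← Complex.conj_eq_iff_re, gPer_eq_fourierSeries, fourierSeries, Complex.conj_tsum,
    ← Equiv.tsum_eq (Equiv.neg _)]
  refine tsum_congr fun m => ?_
  simp only [Equiv.neg_apply, map_mul, map_div₀, Complex.conj_ofReal, norm_dualPt_neg,
    ← coeff_ofReal_neg, neg_neg, ← mFourier_neg]

/-- The integral is the zero mode of a product, hence a convolution at 0; reality of `g` turns the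
coefficient at -m into a conjugate. -/
theorem hasSum_integral_mul_gPer {g : T3 → ℝ} (hg : Integrable g torusMeasure)
    (hs : Summable fun m => ‖coeff (fun t => (g t : ℂ)) m‖ ^ 2) :
    HasSum (fun m => ‖coeff (fun t => (g t : ℂ)) m‖ ^ 2 / ‖dualPt m‖ ^ 2)
      (∫ t, g t * (gPer (fun s => (g s : ℂ)) t).re ∂torusMeasure) := by
  have h := hasSum_coeff_fourierSeries_mul (summable_norm_div_norm_dualPt_sq hs) hg.ofReal 0
  rw [← gPer_eq_fourierSeries] at h
  rw [← Complex.hasSum_ofReal]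
  have e : coeff (fun t => gPer (fun s => (g s : ℂ)) t * (g t : ℂ)) 0
      = ((∫ t, g t * (gPer (fun s => (g s : ℂ)) t).re ∂torusMeasure : ℝ) : ℂ) := by
    rw [coeff_eq_integral, ← integral_complex_ofReal]
    congr 1 with t
    rw [Complex.ofReal_mul, ofReal_re_gPer]
    simp [mFourier_zero, mul_comm]
  change HasSum _ (coeff (fun t => gPer (fun s => (g s : ℂ)) t * (g t : ℂ)) 0) at h
  rw [e] at h
  convert h using 2 with m
  change _ = coeff (fun t => (g t : ℂ)) m / _ * coeff (fun t => (g t : ℂ)) (0 - m)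
  rw [zero_sub, coeff_ofReal_neg, div_mul_eq_mul_div, Complex.mul_conj,
    Complex.normSq_eq_norm_sq]
  push_cast
  rfl

variable {e : ℝ} {σ : E3 → ℝ} {ψ : T3 → ℂ}

theorem integrable_chargeDensity (hσ : MemLp (periodization σ) 2 torusMeasure) (hψ : MemH1 ψ) :
    Integrable (chargeDensity e σ ψ) torusMeasure :=
  (hσ.integrable one_le_two).sub (hψ.integrable_sq.const_mul e)

theorem coeff_chargeDensity (hσ : MemLp (periodization σ) 2 torusMeasure) (hψ : MemH1 ψ)
    (m : Fin 3 → ℤ) : coeff (fun t => (chargeDensity e σ ψ t : ℂ)) m =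
      coeff (fun t => (periodization σ t : ℂ)) m - e * corr (coeff ψ) m := by
  rw [← coeff_norm_sq hψ.1, ← coeff_const_mul, ← coeff_sub]
  · simp [chargeDensity]
  · exact (hσ.integrable one_le_two).ofReal
  · exact hψ.integrable_sq.ofReal.const_mul _

theorem summable_norm_sub_sq {ι : Type*} {f g : ι → ℂ} (hf : Summable fun m => ‖f m‖ ^ 2)
    (hg : Summable fun m => ‖g m‖ ^ 2) : Summable fun m => ‖f m - g m‖ ^ 2 := by
  refine Summable.of_nonneg_of_le (fun _ => sq_nonneg _) (fun m => ?_)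
    ((hf.add hg).mul_left 2)
  have := norm_sub_le (f m) (g m)
  nlinarith [norm_nonneg (f m - g m), sq_nonneg (‖f m‖ - ‖g m‖)]

theorem summable_coeff_sq {f : T3 → ℂ} (hf : MemLp f 2 torusMeasure) :
    Summable fun m => ‖coeff f m‖ ^ 2 := (hasSum_norm_sq_coeff hf).summable

theorem summable_coeff_periodization_sub (hσ : MemLp (periodization σ) 2 torusMeasure)
    {a : (Fin 3 → ℤ) → ℂ} (ha : H1Seq a) : Summable fun m =>
      ‖coeff (fun t => (periodization σ t : ℂ)) m - e * corr a m‖ ^ 2 := by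
  refine summable_norm_sub_sq (summable_coeff_sq hσ.ofReal) ?_
  simp only [norm_mul, mul_pow]
  exact ha.summable_corr_sq.mul_left _

theorem summable_coeff_chargeDensity (hσ : MemLp (periodization σ) 2 torusMeasure)
    (hψ : MemH1 ψ) :
    Summable fun m => ‖coeff (fun t => (chargeDensity e σ ψ t : ℂ)) m‖ ^ 2 := by
  simp only [coeff_chargeDensity hσ hψ]
  exact summable_coeff_periodization_sub hσ hψ.h1Seq

theorem coeff_potential (hσ : MemLp (periodization σ) 2 torusMeasure) (hψ : MemH1 ψ)
    (m : Fin 3 → ℤ) : coeff (fun t => (potential e σ ψ t : ℂ)) m =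
      (coeff (fun t => (periodization σ t : ℂ)) m - e * corr (coeff ψ) m) /
        ((‖dualPt m‖ ^ 2 : ℝ) : ℂ) := by
  simp only [potential, ofReal_re_gPer, ← coeff_chargeDensity hσ hψ]
  rw [show (fun t => gPer (fun s => (chargeDensity e σ ψ s : ℂ)) t)
    = gPer (fun s => (chargeDensity e σ ψ s : ℂ)) from rfl, gPer_eq_fourierSeries,
    coeff_fourierSeries (summable_norm_div_norm_dualPt_sq (summable_coeff_chargeDensity hσ hψ))]

theorem hasSum_coeff_potential_mul (hσ : MemLp (periodization σ) 2 torusMeasure) (hψ : MemH1 ψ)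
    {g : T3 → ℂ} (hg : Integrable g torusMeasure) (m : Fin 3 → ℤ) :
    HasSum (fun k => (coeff (fun t => (periodization σ t : ℂ)) k - e * corr (coeff ψ) k) /
        ((‖dualPt k‖ ^ 2 : ℝ) : ℂ) * coeff g (m - k))
      (coeff (fun t => (potential e σ ψ t : ℂ) * g t) m) := by
  simp only [potential, ofReal_re_gPer, ← coeff_chargeDensity hσ hψ]
  simp only [gPer_eq_fourierSeries]
  exact hasSum_coeff_fourierSeries_mul (summable_norm_div_norm_dualPt_sq
    (summable_coeff_chargeDensity hσ hψ)) hg m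

/-- Twice the energy per cell as a function of the Fourier coefficients `a` of the wave function
and `s` of the ion density. -/
noncomputable def seqEnergy (e : ℝ) (s a : (Fin 3 → ℤ) → ℂ) : ℝ :=
  (∑' m, ‖dualPt m‖ ^ 2 * ‖a m‖ ^ 2) + ∑' m, ‖s m - e * corr a m‖ ^ 2 / ‖dualPt m‖ ^ 2

/-- The energy depends on the wave function only through its coefficients, so the variational
problem can be treated entirely on sequences. -/
theorem cellEnergy_eq_seqEnergy (hσ : MemLp (periodization σ) 2 torusMeasure) (hψ : MemH1 ψ) :
    cellEnergy e σ ψ =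
      1 / 2 * seqEnergy e (coeff fun t => (periodization σ t : ℂ)) (coeff ψ) := by
  have h := hasSum_integral_mul_gPer (integrable_chargeDensity (e := e) hσ hψ)
    (summable_coeff_chargeDensity hσ hψ)
  simp only [coeff_chargeDensity hσ hψ] at h
  rw [seqEnergy, h.tsum_eq]
  rfl

theorem mem_admissible_iff {Z : ℝ} : ψ ∈ admissible Z ↔
    MemH1 ψ ∧ ∑' m, ‖coeff ψ m‖ ^ 2 = Z := by
  constructor
  · rintro ⟨h1, h2⟩
    exact ⟨h1, (hasSum_norm_sq_coeff h1.1).tsum_eq.trans h2⟩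
  · rintro ⟨h1, h2⟩
    exact ⟨h1, (hasSum_norm_sq_coeff h1.1).tsum_eq.symm.trans h2⟩

theorem exists_memH1_coeff_eq {a : (Fin 3 → ℤ) → ℂ} (ha : H1Seq a) :
    ∃ f, MemH1 f ∧ coeff f = a := by
  obtain ⟨f, hf, h⟩ := exists_memLp_coeff_eq ha.summable_sq
  refine ⟨f, ⟨hf, ?_⟩, h⟩
  rw [h]
  exact ha

/-! ### Periodization and the Fourier transform on the dual lattice -/

/-- The vector of `ℝ³` with integer coordinates `n`. -/
noncomputable def intVec (n : Fin 3 → ℤ) : Fin 3 → ℝ := fun i => n i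

/-- The lattice translates of a half-open unit cube tile ℝ³. -/
theorem hasSum_setIntegral_translates {E : Type*} [NormedAddCommGroup E] [NormedSpace ℝ E]
    {g : (Fin 3 → ℝ) → E} (hg : Integrable g) (a : Fin 3 → ℝ) :
    HasSum (fun n => ∫ x in {x : Fin 3 → ℝ | ∀ i, x i ∈ Set.Ioc (a i) (a i + 1)}, g (x - intVec n))
      (∫ x, g x) := by
  set B : Set (Fin 3 → ℝ) := {x | ∀ i, x i ∈ Set.Ioc (a i) (a i + 1)} with hB
  have hBm : MeasurableSet B := MeasurableSet.univ_pi' fun i => measurableSet_Ioc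
  let s : (Fin 3 → ℤ) → Set (Fin 3 → ℝ) := fun n => (fun x => x + intVec n) ⁻¹' B
  have hs : ∀ n, ∫ x in B, g (x - intVec n) = ∫ x in s n, g x := by
    intro n
    rw [← (measurePreserving_sub_right volume (intVec n)).setIntegral_preimage_emb
      (measurableEmbedding_subRight _) g (s n)]
    congr 2
    ext x
    simp [s]
  simp only [hs]
  have hU : ⋃ n, s n = Set.univ := by
    -- For real y one has y + 1 - ⌈y⌉ ∈ (0, 1]; here y = xᵢ - aᵢ.
    refine Set.eq_univ_of_forall fun x => Set.mem_iUnion.2 ⟨fun i => 1 - ⌈x i - a i⌉, fun i => ?_⟩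
    simp only [Pi.add_apply, intVec, Set.mem_Ioc]
    push_cast
    have h1 := Int.ceil_lt_add_one (x i - a i)
    have h2 := Int.le_ceil (x i - a i)
    constructor <;> linarith
  have h := hasSum_integral_iUnion (μ := volume) (f := g) (s := s)
    (fun n => measurable_id.add_const _ hBm) ?_ hg.integrableOn
  · rwa [hU, setIntegral_univ] at h
  · intro m n hmn
    rw [Function.onFun, Set.disjoint_left]
    intro x hm hn
    apply hmn
    ext i
    have h1 := hm i
    have h2 := hn i
    simp only [Pi.add_apply, intVec, Set.mem_Ioc] at h1 h2
    have h3 : (m i : ℝ) < n i + 1 := by linarith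
    have h4 : (n i : ℝ) < m i + 1 := by linarith
    have h5 : m i < n i + 1 := by exact_mod_cast h3
    have h6 : n i < m i + 1 := by exact_mod_cast h4
    omega

theorem integral_tsum_translates {g : (Fin 3 → ℝ) → ℂ} (hg : Integrable g) (a : Fin 3 → ℝ) :
    ∫ x in {x : Fin 3 → ℝ | ∀ i, x i ∈ Set.Ioc (a i) (a i + 1)}, ∑' n, g (x - intVec n)
      = ∫ x, g x := by
  have h := hasSum_integral_of_summable_integral_norm
    (μ := volume.restrict {x : Fin 3 → ℝ | ∀ i, x i ∈ Set.Ioc (a i) (a i + 1)})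
    (F := fun n x => g (x - intVec n)) (fun n => (hg.comp_sub_right _).integrableOn)
    (hasSum_setIntegral_translates hg.norm a).summable
  exact h.unique (hasSum_setIntegral_translates hg a)

/-- The representative in [0, 1) differs from x by a lattice vector, which a reindexing of the sum
absorbs. An unconditional sum is invariant under bijections even when it diverges, so no decay of σ
is needed. -/
theorem periodization_coe (σ : E3 → ℝ) (x : Fin 3 → ℝ) :
    periodization σ (fun i => (x i : UnitAddCircle)) =
      ∑' n, σ (WithLp.toLp 2 (x - intVec n)) := by
  have hk : ∀ i, ∃ k : ℤ, (AddCircle.equivIco (1 : ℝ) 0 (x i : UnitAddCircle) : ℝ) = x i - k := by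
    intro i
    have h : ((AddCircle.equivIco (1 : ℝ) 0 (x i : UnitAddCircle) : ℝ) : UnitAddCircle) = x i :=
      AddCircle.coe_equivIco
    rw [← sub_eq_zero, ← AddCircle.coe_sub, AddCircle.coe_eq_zero_iff] at h
    obtain ⟨k, hk⟩ := h
    refine ⟨-k, ?_⟩
    simp only [zsmul_eq_mul, mul_one] at hk
    push_cast
    linarith
  choose k hk using hk
  rw [periodization, ← Equiv.tsum_eq (Equiv.addLeft k)
    (fun n => σ (WithLp.toLp 2 (x - intVec n)))]
  refine tsum_congr fun n => ?_
  congr 2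
  ext i
  rw [hk]
  simp [intVec]
  ring

theorem mFourier_coe (m : Fin 3 → ℤ) (x : Fin 3 → ℝ) :
    mFourier m (fun i => (x i : UnitAddCircle)) =
      Complex.exp (Complex.I * ((inner ℝ (dualPt m) (WithLp.toLp 2 x) : ℝ) : ℂ)) := by
  simp only [mFourier, ContinuousMap.coe_mk, fourier_coe_apply, ← Complex.exp_sum]
  congr 1
  simp only [dualPt, PiLp.inner_apply, RCLike.inner_apply, conj_trivial]
  push_cast
  rw [Finset.mul_sum]
  refine Finset.sum_congr rfl fun i _ => ?_
  simp
  ring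

/-- The Fourier coefficients of the periodization are the values of the Fourier transform on the
dual lattice. -/
theorem coeff_periodization {σ : E3 → ℝ} (hσ : Integrable σ volume) (m : Fin 3 → ℤ) :
    coeff (fun t => (periodization σ t : ℂ)) m = conj (fourierT σ (dualPt m)) := by
  let g : (Fin 3 → ℝ) → ℂ := fun x =>
    mFourier (-m) (fun i => (x i : UnitAddCircle)) * (σ (WithLp.toLp 2 x) : ℂ)
  have hper : ∀ (x : Fin 3 → ℝ) (n : Fin 3 → ℤ),
      mFourier (-m) (fun i => ((x - intVec n) i : UnitAddCircle))
        = mFourier (-m) (fun i => (x i : UnitAddCircle)) := by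
    intro x n
    congr 1
    ext i
    simp only [Pi.sub_apply, intVec]
    rw [AddCircle.coe_sub, sub_eq_self]
    exact (AddCircle.coe_eq_zero_iff 1).2 ⟨n i, by simp⟩
  have hg : Integrable g := by
    have h1 : Integrable (fun x : Fin 3 → ℝ => (σ (WithLp.toLp 2 x) : ℂ)) :=
      ((PiLp.volume_preserving_toLp (Fin 3)).integrable_comp_emb
        (MeasurableEquiv.toLp 2 (Fin 3 → ℝ)).measurableEmbedding).2 hσ |>.ofReal
    refine h1.bdd_mul (c := 1) ?_ (Eventually.of_forall fun x => (norm_mFourier_apply _ _).le)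
    refine Continuous.aestronglyMeasurable ?_
    refine (mFourier (-m)).continuous.comp (continuous_pi fun i => ?_)
    exact (AddCircle.continuous_mk' 1).comp (continuous_apply i)
  have h1 : coeff (fun t => (periodization σ t : ℂ)) m = ∫ x, g x := by
    rw [← integral_tsum_translates hg 0]
    rw [coeff, mFourierCoeff_eq_integral _ _ 0]
    congr 1 with x
    simp only [g, hper, tsum_mul_left, periodization_coe, smul_eq_mul]
    push_cast
    rfl
  rw [h1, fourierT, ← integral_conj, ← (PiLp.volume_preserving_toLp (Fin 3)).integral_comp
    (MeasurableEquiv.toLp 2 (Fin 3 → ℝ)).measurableEmbedding]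
  congr 1 with x
  simp only [g, mFourier_neg, mFourier_coe, map_mul, Complex.conj_ofReal]

theorem periodization_const_mul (e : ℝ) (σ : E3 → ℝ) :
    periodization (fun x => e * σ x) = fun t => e * periodization σ t := by
  ext t
  exact tsum_mul_left

theorem fourierT_const_mul (e : ℝ) (σ : E3 → ℝ) (ξ : E3) :
    fourierT (fun x => e * σ x) ξ = e * fourierT σ ξ := by
  simp only [fourierT, ← integral_const_mul]
  congr 1 with x
  push_cast
  ring

/-! ### Small charge: the electron density is nearly constant -/

/-- A sequence with its zero mode removed. -/
noncomputable def dropZero (a : (Fin 3 → ℤ) → ℂ) (m : Fin 3 → ℤ) : ℂ := if m = 0 then 0 else a m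

theorem norm_dropZero_le (a : (Fin 3 → ℤ) → ℂ) (m : Fin 3 → ℤ) : ‖dropZero a m‖ ≤ ‖a m‖ := by
  unfold dropZero; split_ifs <;> simp

theorem H1Seq.dropZero {a : (Fin 3 → ℤ) → ℂ} (ha : H1Seq a) : H1Seq (dropZero a) :=
  Summable.of_nonneg_of_le (fun m => mul_nonneg (weight_nonneg m) (sq_nonneg _))
    (fun m => by have := norm_dropZero_le a m; have := weight_nonneg m; gcongr) ha

/-- Poincaré inequality: off the zero mode |2πm|² ≥ 1, so the weight is at most 2|2πm|². -/
theorem H1Seq.h1Sq_dropZero_le {a : (Fin 3 → ℤ) → ℂ} (ha : H1Seq a) :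
    h1Sq (Crystal.dropZero a) ≤ 2 * ∑' m, ‖dualPt m‖ ^ 2 * ‖a m‖ ^ 2 := by
  rw [← tsum_mul_left]
  refine ha.dropZero.tsum_le_tsum (fun m => ?_) (ha.summable_norm_dualPt_sq.mul_left 2)
  by_cases hm : m = 0
  · simp [hm, Crystal.dropZero]
  · have := one_le_norm_dualPt_sq hm
    simp only [Crystal.dropZero, hm, if_false, ← mul_assoc]
    gcongr
    unfold weight
    linarith

/-- If m ≠ 0, then k and k + m are not both zero, so each term of the correlation has at least one
factor from the nonconstant part. -/
theorem norm_dropZero_corr_le {a : (Fin 3 → ℤ) → ℂ} (ha : H1Seq a) (m : Fin 3 → ℤ) :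
    ‖dropZero (corr a) m‖ ≤ (∑' k, ‖dropZero a (k + m)‖ * ‖a k‖) +
      ∑' k, ‖a (k + m)‖ * ‖dropZero a k‖ := by
  by_cases hm : m = 0
  · simp only [hm, dropZero, if_true, norm_zero]
    exact add_nonneg (tsum_nonneg fun k => by positivity) (tsum_nonneg fun k => by positivity)
  · have h1 := summable_norm_mul_shift ha.dropZero.summable_sq ha.summable_sq m
    have h2 := summable_norm_mul_shift ha.summable_sq ha.dropZero.summable_sq m
    have h3 := summable_norm_mul_shift ha.summable_sq ha.summable_sq m
    rw [← h1.tsum_add h2]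
    simp only [dropZero, hm, if_false]
    refine (norm_corr_le ha m).trans (h3.tsum_le_tsum (fun k => ?_) (h1.add h2))
    by_cases hk : k = 0
    · subst hk
      simp [hm]
    · simp only [hk, if_false]
      have : 0 ≤ ‖if k + m = 0 then 0 else a (k + m)‖ * ‖a k‖ := by positivity
      linarith

/-- The fluctuation of |ψ|² is controlled by the nonconstant part of ψ, to first order. This gives
the O(e) correction in T̂₂. -/
theorem tsum_norm_dropZero_corr_sq_le {a : (Fin 3 → ℤ) → ℂ} (ha : H1Seq a) :
    (Summable fun m => ‖dropZero (corr a) m‖ ^ 2) ∧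
    ∑' m, ‖dropZero (corr a) m‖ ^ 2 ≤ 4 * weightConst * (h1Sq (dropZero a) * h1Sq a) := by
  obtain ⟨s1, b1⟩ := ha.dropZero.corr_bound ha
  obtain ⟨s2, b2⟩ := ha.corr_bound ha.dropZero
  have hle : ∀ m, ‖dropZero (corr a) m‖ ^ 2 ≤ 2 * ((∑' k, ‖dropZero a (k + m)‖ * ‖a k‖) ^ 2 +
      (∑' k, ‖a (k + m)‖ * ‖dropZero a k‖) ^ 2) := by
    intro m
    have h := norm_dropZero_corr_le ha m
    have h0 := norm_nonneg (dropZero (corr a) m)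
    generalize (∑' k, ‖dropZero a (k + m)‖ * ‖a k‖) = x at h
    generalize (∑' k, ‖a (k + m)‖ * ‖dropZero a k‖) = y at h
    nlinarith [sq_nonneg (x - y)]
  have hs := (s1.add s2).mul_left 2
  have hs' := Summable.of_nonneg_of_le (fun _ => sq_nonneg _) hle hs
  refine ⟨hs', (hs'.tsum_le_tsum hle hs).trans ?_⟩
  rw [tsum_mul_left, s1.tsum_add s2]
  linarith

/-- The constant function `√Z`, on Fourier coefficients. -/
noncomputable def constSeq (Z : ℝ) (m : Fin 3 → ℤ) : ℂ := if m = 0 then (√Z : ℂ) else 0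

theorem constSeq_of_ne (Z : ℝ) {m : Fin 3 → ℤ} (hm : m ≠ 0) : constSeq Z m = 0 := by
  simp [constSeq, hm]

theorem h1Seq_constSeq (Z : ℝ) : H1Seq (constSeq Z) :=
  summable_of_ne_finset_zero (s := {0}) fun m hm => by
    simp [constSeq_of_ne Z (by simpa using hm)]

theorem tsum_norm_constSeq_sq {Z : ℝ} (hZ : 0 ≤ Z) : ∑' m, ‖constSeq Z m‖ ^ 2 = Z := by
  rw [tsum_eq_single 0 fun m hm => by simp [constSeq_of_ne Z hm]]
  simp [constSeq, Real.sq_sqrt hZ]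

theorem corr_constSeq_of_ne (Z : ℝ) {m : Fin 3 → ℤ} (hm : m ≠ 0) : corr (constSeq Z) m = 0 := by
  rw [corr, tsum_eq_single 0 fun k hk => by simp [constSeq_of_ne Z hk]]
  simp [constSeq_of_ne Z hm]

/-- A constant wave function has a constant density, which only affects the zero mode ignored by the
Coulomb energy. -/
theorem seqEnergy_constSeq (e Z : ℝ) (s : (Fin 3 → ℤ) → ℂ) :
    seqEnergy e s (constSeq Z) = ∑' m, ‖s m‖ ^ 2 / ‖dualPt m‖ ^ 2 := by
  rw [seqEnergy]
  have h1 : ∀ m, ‖dualPt m‖ ^ 2 * ‖constSeq Z m‖ ^ 2 = 0 := fun m => by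
    by_cases hm : m = 0
    · simp [hm]
    · simp [constSeq_of_ne Z hm]
  simp only [h1, tsum_zero, zero_add]
  refine tsum_congr fun m => ?_
  by_cases hm : m = 0
  · simp [hm]
  · simp [corr_constSeq_of_ne Z hm]

variable {Z e : ℝ} {μ : E3 → ℝ}

theorem memLp_periodization_const_mul (hμ : IsIonDensity Z μ) (e : ℝ) :
    MemLp (periodization fun x => e * μ x) 2 torusMeasure := by
  rw [periodization_const_mul]
  exact hμ.periodization_memLp.const_mul e

theorem coeff_periodization_const_mul (hμ : IsIonDensity Z μ) (e : ℝ) (m : Fin 3 → ℤ) :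
    coeff (fun t => (periodization (fun x => e * μ x) t : ℂ)) m =
      e * conj (fourierT μ (dualPt m)) := by
  rw [coeff_periodization (hμ.integrable.const_mul e), fourierT_const_mul, map_mul,
    Complex.conj_ofReal]

theorem summable_norm_fourierT_sq (hμ : IsIonDensity Z μ) :
    Summable fun m => ‖fourierT μ (dualPt m)‖ ^ 2 := by
  have := summable_coeff_sq (hμ.periodization_memLp.ofReal (K := ℂ))
  simp only [RCLike.ofReal_eq_complex_ofReal] at this
  simpa only [coeff_periodization hμ.integrable, RCLike.norm_conj] using this

/-- The kinetic energy of a ground state is of order `e²`. -/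
theorem IsRealGroundState.kinetic_le (hZ : 0 < Z) (hμ : IsIonDensity Z μ) {ψ : T3 → ℝ} {ω : ℝ}
    (h : IsRealGroundState Z e (fun x => e * μ x) ψ ω) :
    ∑' m, ‖dualPt m‖ ^ 2 * ‖coeff (fun t => (ψ t : ℂ)) m‖ ^ 2 ≤
      e ^ 2 * ∑' m, ‖fourierT μ (dualPt m)‖ ^ 2 / ‖dualPt m‖ ^ 2 := by
  -- The competitor is the constant √Z; its energy is half the right-hand side of the claim.
  obtain ⟨φ, hφ, hc⟩ := exists_memH1_coeff_eq (h1Seq_constSeq Z)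
  have hmin := h.minimal φ (mem_admissible_iff.2 ⟨hφ, by rw [hc, tsum_norm_constSeq_sq hZ.le]⟩)
  have hs := memLp_periodization_const_mul hμ e
  rw [cellEnergy_eq_seqEnergy hs h.mem.1, cellEnergy_eq_seqEnergy hs hφ, hc,
    seqEnergy_constSeq] at hmin
  simp only [coeff_periodization_const_mul hμ, norm_mul, RCLike.norm_conj, mul_pow,
    Complex.norm_real, mul_div_assoc, tsum_mul_left, Real.norm_eq_abs, sq_abs] at hmin
  refine le_trans ?_ (le_of_mul_le_mul_left hmin (by norm_num))
  rw [seqEnergy]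
  -- The Coulomb energy of the ground state is nonnegative and is discarded.
  exact le_add_of_nonneg_right (tsum_nonneg fun m => by positivity)

/-! ### The matrix T̂₂ to leading order in e -/

/-- The values of the quadratic form of `T̂₂`. -/
theorem hasSum_matrixT2_form (hμ : IsIonDensity Z μ) {ψ : T3 → ℝ}
    (hψ : MemH1 fun t => (ψ t : ℂ)) (v : E3) :
    HasSum (fun m => -e ^ 2 * ((inner ℝ v (dualPt m)) ^ 2 / ‖dualPt m‖ ^ 2 *
        (‖fourierT μ (dualPt m)‖ ^ 2 -
          (corr (coeff fun t => (ψ t : ℂ)) m * fourierT μ (dualPt m)).re)))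
      (∑ i, ∑ j, v i * matrixT2 e (fun x => e * μ x) ψ i j * v j) := by
  set a := coeff fun t => (ψ t : ℂ) with ha
  have haH : H1Seq a := hψ.h1Seq
  let F : (Fin 3 → ℤ) → ℂ := fun m => (e * conj (fourierT μ (dualPt m)) - e * corr a m) /
    ((‖dualPt m‖ ^ 2 : ℝ) : ℂ)
  have hF : ∀ m, coeff (fun t => (potential e (fun x => e * μ x) (fun s => (ψ s : ℂ)) t : ℂ)) m
      = F m := fun m => by
    rw [coeff_potential (memLp_periodization_const_mul hμ e) hψ, coeff_periodization_const_mul hμ]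
  have hsum : ∀ i j, Summable fun m => F m * (-((dualPt m i * dualPt m j : ℝ) : ℂ) *
      (e * fourierT μ (dualPt m))) := by
    intro i j
    have hg : Summable fun m => ‖e * conj (fourierT μ (dualPt m)) - e * corr a m‖ ^ 2 := by
      have := summable_coeff_periodization_sub (e := e) (memLp_periodization_const_mul hμ e) haH
      simpa only [coeff_periodization_const_mul hμ] using this
    refine Summable.of_norm_bounded
      ((summable_mul_of_sq hg (summable_norm_fourierT_sq hμ)).mul_left |e|) fun m => ?_
    by_cases hm : m = 0
    · simp only [hm, F, dualPt_zero, norm_zero]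
      simpa using by positivity
    have hq := one_le_norm_dualPt_sq hm
    -- The two derivatives of σ cancel the Coulomb denominator, leaving a product of two ℓ²
    -- sequences.
    have hij : |dualPt m i * dualPt m j| ≤ ‖dualPt m‖ ^ 2 := by
      rw [abs_mul, sq]
      exact mul_le_mul (PiLp.norm_apply_le (dualPt m) i) (PiLp.norm_apply_le (dualPt m) j) (abs_nonneg _)
        (norm_nonneg _)
    simp only [F, norm_mul, norm_div, norm_neg, Complex.norm_real, Real.norm_eq_abs, abs_pow,
      abs_norm]
    rw [abs_mul] at hij
    calc _ = (|dualPt m i| * |dualPt m j| / ‖dualPt m‖ ^ 2) *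
          (|e| * (‖e * conj (fourierT μ (dualPt m)) - e * corr a m‖ * ‖fourierT μ (dualPt m)‖)) := by
          ring
      _ ≤ 1 * _ := by
          exact mul_le_mul_of_nonneg_right ((div_le_one (by linarith)).2 hij) (by positivity)
      _ = _ := one_mul _
  have hT : ∀ i j, HasSum (fun m => (F m * (-((dualPt m i * dualPt m j : ℝ) : ℂ) *
      (e * fourierT μ (dualPt m)))).re) (matrixT2 e (fun x => e * μ x) ψ i j) := by
    intro i j
    simp only [matrixT2, Matrix.of_apply, hF, fourierT_const_mul]
    exact Complex.hasSum_re (hsum i j).hasSum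
  have h := hasSum_sum (s := Finset.univ) fun i _ => hasSum_sum (s := Finset.univ) fun j _ =>
    ((hT i j).mul_left (v i)).mul_right (v j)
  refine h.congr_fun fun m => ?_
  by_cases hm : m = 0
  · simp [hm, F]
  have hq : ‖dualPt m‖ ^ 2 ≠ 0 := by linarith [one_le_norm_dualPt_sq hm]
  have e1 : ∀ i j, (F m * (-((dualPt m i * dualPt m j : ℝ) : ℂ) *
      (e * fourierT μ (dualPt m)))).re = -e ^ 2 * (dualPt m i * dualPt m j / ‖dualPt m‖ ^ 2 *
        (‖fourierT μ (dualPt m)‖ ^ 2 - (corr a m * fourierT μ (dualPt m)).re)) := by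
    intro i j
    have : F m * (-((dualPt m i * dualPt m j : ℝ) : ℂ) * (e * fourierT μ (dualPt m))) =
        ((-e ^ 2 * (dualPt m i * dualPt m j / ‖dualPt m‖ ^ 2) : ℝ) : ℂ) *
          (((‖fourierT μ (dualPt m)‖ ^ 2 : ℝ) : ℂ) - corr a m * fourierT μ (dualPt m)) := by
      rw [← Complex.normSq_eq_norm_sq, ← Complex.mul_conj]
      simp only [F]
      push_cast
      ring
    rw [this, Complex.re_ofReal_mul, Complex.sub_re, Complex.ofReal_re]
    ring
  simp only [e1]
  have e2 : inner ℝ v (dualPt m) = ∑ i, v i * dualPt m i := by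
    simp [PiLp.inner_apply, mul_comm]
  rw [e2, sq (∑ i, v i * dualPt m i), Finset.sum_mul_sum, Finset.sum_div, Finset.sum_mul,
    Finset.mul_sum]
  refine Finset.sum_congr rfl fun i _ => ?_
  rw [Finset.sum_div, Finset.sum_mul, Finset.mul_sum]
  refine Finset.sum_congr rfl fun j _ => ?_
  ring

theorem inner_sq_div_le (v w : E3) : (inner ℝ v w) ^ 2 / ‖w‖ ^ 2 ≤ ‖v‖ ^ 2 := by
  by_cases hw : w = 0
  · simp [hw]
  · rw [div_le_iff₀ (by positivity), ← mul_pow, sq_le_sq, abs_mul, abs_norm, abs_norm]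
    exact abs_real_inner_le_norm v w

/-- To leading order `T̂₂` is the negative of the lattice sum of `ξ ⊗ ξ |μ̃(ξ)|² / |ξ|²`. -/
theorem exists_matrixT2_form_le (hZ : 0 < Z) (hμ : IsIonDensity Z μ) (v : E3) {δ : ℝ}
    (hδ : 0 < δ) : ∃ e₀ : ℝ, 0 < e₀ ∧ ∀ e : ℝ, 0 < e → e < e₀ → ∀ (ψ : T3 → ℝ) (ω : ℝ),
      IsRealGroundState Z e (fun x => e * μ x) ψ ω →
        ∑ i, ∑ j, v i * matrixT2 e (fun x => e * μ x) ψ i j * v j ≤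
          -e ^ 2 * ((∑' m, (inner ℝ v (dualPt m)) ^ 2 / ‖dualPt m‖ ^ 2 *
            ‖fourierT μ (dualPt m)‖ ^ 2) - δ) := by
  set N := ∑' m, ‖fourierT μ (dualPt m)‖ ^ 2 / ‖dualPt m‖ ^ 2 with hN
  have hN0 : 0 ≤ N := tsum_nonneg fun m => by positivity
  set C := ∑' m, ‖fourierT μ (dualPt m)‖ ^ 2 with hC
  have hC0 : 0 ≤ C := tsum_nonneg fun m => by positivity
  -- Chosen so that the density fluctuation paired with μ̃ is at most e·D: the factor 8 is 4 from
  -- the correlation bound times 2 from the Poincaré inequality.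
  set D := √(8 * weightConst * N * (Z + N) * C) with hD
  have hD0 : 0 ≤ D := Real.sqrt_nonneg _
  -- The bound e < 1 keeps the H¹ norm below Z + N; the other bound makes the error |v|²De at most
  -- δ. The added 1 only keeps the denominator positive.
  refine ⟨min 1 (δ / (‖v‖ ^ 2 * D + 1)), lt_min one_pos (by positivity),
    fun e he0 he ψ ω hgs => ?_⟩
  have he1 : e < 1 := he.trans_le (min_le_left _ _)
  have he2 : ‖v‖ ^ 2 * D * e ≤ δ := by
    have := (lt_div_iff₀ (by positivity)).1 (he.trans_le (min_le_right _ _))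
    nlinarith
  set a := coeff fun t => (ψ t : ℂ) with ha
  have haH : H1Seq a := hgs.mem.1.h1Seq
  have hK := hgs.kinetic_le hZ hμ
  rw [← hN, ← ha] at hK
  set K := ∑' m, ‖dualPt m‖ ^ 2 * ‖a m‖ ^ 2 with hKdef
  have hK0 : 0 ≤ K := tsum_nonneg fun m => by positivity
  have ha1 : h1Sq a ≤ Z + N := by
    rw [haH.h1Sq_eq, (mem_admissible_iff.1 hgs.mem).2, ← hKdef]
    nlinarith [mul_nonneg hN0 (by nlinarith : 0 ≤ 1 - e ^ 2)]
  have ha2 : h1Sq (dropZero a) ≤ 2 * (e ^ 2 * N) := haH.h1Sq_dropZero_le.trans (by linarith)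
  obtain ⟨hps, hpb⟩ := tsum_norm_dropZero_corr_sq_le haH
  have hpb' : ∑' m, ‖dropZero (corr a) m‖ ^ 2 ≤ e ^ 2 * (8 * weightConst * N * (Z + N)) := by
    have := mul_le_mul ha2 ha1 (h1Sq_nonneg _) (by positivity)
    have := mul_le_mul_of_nonneg_left this (mul_nonneg (by norm_num : (0:ℝ) ≤ 4) weightConst_nonneg)
    linarith
  have hcs := summable_norm_fourierT_sq hμ
  have hpc : ∑' m, ‖dropZero (corr a) m‖ * ‖fourierT μ (dualPt m)‖ ≤ e * D := by
    refine (pow_le_pow_iff_left₀ (tsum_nonneg fun m => by positivity) (by positivity) two_ne_zero).1 ?_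
    refine (tsum_mul_sq_le hps hcs).trans ?_
    rw [mul_pow, hD, Real.sq_sqrt (by have := weightConst_nonneg; positivity), ← mul_assoc]
    exact mul_le_mul_of_nonneg_right hpb' hC0
  have h := hasSum_matrixT2_form (e := e) hμ hgs.mem.1 v
  have h1s : Summable fun m => (inner ℝ v (dualPt m)) ^ 2 / ‖dualPt m‖ ^ 2 *
            ‖fourierT μ (dualPt m)‖ ^ 2 :=
    Summable.of_nonneg_of_le (fun m => by positivity)
      (fun m => mul_le_mul_of_nonneg_right (inner_sq_div_le v _) (sq_nonneg _)) (hcs.mul_left _)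
  have h2s := (summable_mul_of_sq hps hcs).mul_left (‖v‖ ^ 2)
  have hle := hasSum_le (fun m => ?_) h ((h1s.hasSum.sub h2s.hasSum).mul_left (-e ^ 2))
  · refine hle.trans ?_
    rw [tsum_mul_left]
    have : ‖v‖ ^ 2 * ∑' m, ‖dropZero (corr a) m‖ * ‖fourierT μ (dualPt m)‖ ≤ δ := by
      refine (mul_le_mul_of_nonneg_left hpc (sq_nonneg _)).trans ?_
      linarith
    nlinarith [sq_nonneg e]
  · rw [neg_mul, neg_mul, neg_le_neg_iff]
    refine mul_le_mul_of_nonneg_left ?_ (sq_nonneg e)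
    rw [mul_sub]
    refine sub_le_sub_left ?_ _
    by_cases hm : m = 0
    · simp [hm, dropZero]
    · simp only [dropZero, hm, if_false]
      refine (mul_le_mul_of_nonneg_left ((Complex.re_le_norm _).trans_eq (norm_mul _ _))
        (by positivity)).trans ?_
      exact mul_le_mul_of_nonneg_right (inner_sq_div_le v _) (by positivity)

/-- The quadratic form of `T̂₂` is negative at the points of the dual lattice at which `μ̃` does not
vanish. -/
theorem exists_matrixT2_form_neg (hZ : 0 < Z) (hμ : IsIonDensity Z μ) {m : Fin 3 → ℤ} (hm : m ≠ 0)
    (hmμ : fourierT μ (dualPt m) ≠ 0) : ∃ e₀ : ℝ, 0 < e₀ ∧ ∀ e : ℝ, 0 < e → e < e₀ →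
      ∀ (ψ : T3 → ℝ) (ω : ℝ), IsRealGroundState Z e (fun x => e * μ x) ψ ω →
        ∑ i, ∑ j, dualPt m i * matrixT2 e (fun x => e * μ x) ψ i j * dualPt m j < 0 := by
  set δ := ‖dualPt m‖ ^ 2 * ‖fourierT μ (dualPt m)‖ ^ 2 with hδ
  have hq := one_le_norm_dualPt_sq hm
  have hδ0 : 0 < δ := mul_pos (by linarith) (pow_pos (norm_pos_iff.2 hmμ) 2)
  -- The single lattice point 2πm contributes δ to the leading sum, so an error of δ/2 leaves a
  -- negative value.
  obtain ⟨e₀, he₀, h⟩ := exists_matrixT2_form_le hZ hμ (dualPt m) (half_pos hδ0)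
  refine ⟨e₀, he₀, fun e he he' ψ ω hgs => (h e he he' ψ ω hgs).trans_lt ?_⟩
  have h1s : Summable fun k => (inner ℝ (dualPt m) (dualPt k)) ^ 2 / ‖dualPt k‖ ^ 2 *
            ‖fourierT μ (dualPt k)‖ ^ 2 :=
    Summable.of_nonneg_of_le (fun m => by positivity)
      (fun k => mul_le_mul_of_nonneg_right (inner_sq_div_le _ _) (sq_nonneg _))
      ((summable_norm_fourierT_sq hμ).mul_left _)
  have := h1s.le_tsum m fun k _ => by positivity
  rw [real_inner_self_eq_norm_sq, sq (‖dualPt m‖ ^ 2), mul_div_assoc,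
    div_self (by positivity), mul_one, ← hδ] at this
  have : 0 < e ^ 2 := by positivity
  nlinarith

/-! ### Existence of a minimizer by the direct method -/

/-- Balls of `H¹(T³)`, on Fourier coefficients. -/
def h1Ball (B : ℝ) : Set ((Fin 3 → ℤ) → ℂ) := {a | H1Seq a ∧ h1Sq a ≤ B}

/-- Finite partial sums involve finitely many coordinates, so this form shows closedness under
pointwise convergence. -/
theorem h1Ball_eq (B : ℝ) :
    h1Ball B = ⋂ s : Finset (Fin 3 → ℤ), {a | ∑ m ∈ s, weight m * ‖a m‖ ^ 2 ≤ B} := by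
  have h0 : ∀ (a : (Fin 3 → ℤ) → ℂ) m, 0 ≤ weight m * ‖a m‖ ^ 2 := fun a m =>
    mul_nonneg (weight_nonneg m) (sq_nonneg _)
  ext a
  simp only [h1Ball, Set.mem_ofPred_eq, Set.mem_iInter]
  constructor
  · rintro ⟨h1, h2⟩ s
    exact (h1.sum_le_tsum s fun m _ => h0 a m).trans h2
  · intro h
    have hs : H1Seq a := summable_of_sum_le (h0 a) h
    exact ⟨hs, hs.tsum_le_of_sum_le h⟩

theorem isClosed_h1Ball (B : ℝ) : IsClosed (h1Ball B) := by
  rw [h1Ball_eq]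
  refine isClosed_iInter fun s => isClosed_le ?_ continuous_const
  fun_prop

/-- Tychonoff: each coefficient is confined to a disc, and the ball is closed in the product. -/
theorem isCompact_h1Ball (B : ℝ) : IsCompact (h1Ball B) := by
  refine IsCompact.of_isClosed_subset (isCompact_univ_pi fun _ : Fin 3 → ℤ =>
    isCompact_closedBall (0 : ℂ) √B) (isClosed_h1Ball B) fun a ha m _ => ?_
  rw [mem_closedBall_zero_iff]
  refine Real.le_sqrt_of_sq_le ?_
  rw [h1Ball_eq] at ha
  have := Set.mem_iInter.1 ha {m}
  simp only [Finset.sum_singleton, Set.mem_ofPred_eq] at this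
  exact (le_mul_of_one_le_left (sq_nonneg _) (one_le_weight m)).trans this

theorem hasSum_corr {a b : (Fin 3 → ℤ) → ℂ} (ha : Summable fun m => ‖a m‖ ^ 2)
    (hb : Summable fun m => ‖b m‖ ^ 2) (m : Fin 3 → ℤ) :
    HasSum (fun k => a (k + m) * conj (b k)) (∑' k, a (k + m) * conj (b k)) :=
  (Summable.of_norm (by simpa using summable_norm_mul_shift ha hb m)).hasSum

/-- Rellich compactness: correlations are continuous on bounded sets of `H¹(T³)` for the topology
of pointwise convergence of the Fourier coefficients. -/
theorem continuousOn_corr (B : ℝ) (m : Fin 3 → ℤ) :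
    ContinuousOn (fun a => corr a m) (h1Ball B) := by
  have hu : TendstoUniformlyOn
      (fun (s : Finset (Fin 3 → ℤ)) (a : (Fin 3 → ℤ) → ℂ) => ∑ k ∈ s, a (k + m) * conj (a k))
      (fun a => corr a m) atTop (h1Ball B) := by
    rw [Metric.tendstoUniformlyOn_iff]
    intro ε hε
    -- With this η the Cauchy–Schwarz bound of the tail, B · ηB, is below ε².
    set η := ε ^ 2 / (B ^ 2 + 1) with hη
    have hη0 : 0 < η := by positivity
    have hev : ∀ᶠ k in cofinite, (weight k)⁻¹ < η :=
      tendsto_inv_weight.eventually (gt_mem_nhds hη0)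
    filter_upwards [eventually_ge_atTop (Set.Finite.toFinset hev)] with s hs a ha
    have hB : 0 ≤ B := (h1Sq_nonneg a).trans ha.2
    have hk : ∀ k, k ∉ s → (weight k)⁻¹ < η := by
      intro k hk
      by_contra h
      exact hk (hs ((Set.Finite.mem_toFinset _).2 h))
    -- The tail of `a` outside `s`. There weight⁻¹ < η, so its ℓ² mass is at most ηB uniformly on
    -- the ball.
    let b : (Fin 3 → ℤ) → ℂ := fun k => if k ∈ s then 0 else a k
    have hbη : ∀ k, ‖b k‖ ^ 2 ≤ η * (weight k * ‖a k‖ ^ 2) := by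
      intro k
      have hw := weight_pos k
      simp only [b]
      split_ifs with h
      · rw [norm_zero, zero_pow two_ne_zero]; positivity
      · have := (inv_lt_iff_one_lt_mul₀ hw).1 (hk k h)
        rw [← mul_assoc]
        exact le_mul_of_one_le_left (sq_nonneg _) (by linarith)
    have hηs := ha.1.mul_left η
    have hbs : Summable fun k => ‖b k‖ ^ 2 :=
      Summable.of_nonneg_of_le (fun _ => sq_nonneg _) hbη hηs
    have hbB : ∑' k, ‖b k‖ ^ 2 ≤ η * B := by
      refine (hbs.tsum_le_tsum hbη hηs).trans ?_
      rw [tsum_mul_left]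
      exact mul_le_mul_of_nonneg_left ha.2 hη0.le
    have haB : ∑' k, ‖a k‖ ^ 2 ≤ B := by
      refine le_trans ?_ ha.2
      exact ha.1.summable_sq.tsum_le_tsum
        (fun k => le_mul_of_one_le_left (sq_nonneg _) (one_le_weight k)) ha.1
    have hdiff : corr a m - ∑ k ∈ s, a (k + m) * conj (a k) = ∑' k, a (k + m) * conj (b k) := by
      have h1 := hasSum_corr ha.1.summable_sq ha.1.summable_sq m
      have h2 : HasSum (fun k => if k ∈ s then a (k + m) * conj (a k) else 0)
          (∑ k ∈ s, a (k + m) * conj (a k)) := by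
        have : HasSum (fun k => if k ∈ s then a (k + m) * conj (a k) else 0)
            (∑ k ∈ s, if k ∈ s then a (k + m) * conj (a k) else 0) :=
          hasSum_sum_of_ne_finset_zero fun k hk => if_neg hk
        rwa [Finset.sum_ite_mem, Finset.inter_self] at this
      rw [corr, ← (h1.sub h2).tsum_eq]
      refine tsum_congr fun k => ?_
      simp only [b]
      split_ifs <;> simp
    rw [dist_eq_norm, hdiff]
    have hs1 := summable_norm_mul_shift ha.1.summable_sq hbs m
    have hle : ‖∑' k, a (k + m) * conj (b k)‖ ≤ ∑' k, ‖a (k + m)‖ * ‖b k‖ :=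
      tsum_of_norm_bounded hs1.hasSum fun k => by simp
    refine hle.trans_lt (lt_of_pow_lt_pow_left₀ 2 hε.le ?_)
    have h3 := tsum_mul_sq_le (summable_shift ha.1.summable_sq m) hbs
    rw [tsum_shift (fun k => ‖a k‖ ^ 2) m] at h3
    refine h3.trans_lt ?_
    calc _ ≤ B * (η * B) := mul_le_mul haB hbB (tsum_nonneg fun _ => sq_nonneg _) hB
      _ = ε ^ 2 * (B ^ 2 / (B ^ 2 + 1)) := by rw [hη]; ring
      _ < ε ^ 2 * 1 := by
        refine mul_lt_mul_of_pos_left ?_ (by positivity)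
        rw [div_lt_one (by positivity)]
        linarith
      _ = ε ^ 2 := mul_one _
  refine hu.continuousOn (Frequently.of_forall fun s => Continuous.continuousOn ?_)
  fun_prop

theorem corr_zero {a : (Fin 3 → ℤ) → ℂ} : corr a 0 = ((∑' m, ‖a m‖ ^ 2 : ℝ) : ℂ) := by
  rw [corr, Complex.ofReal_tsum]
  refine tsum_congr fun m => ?_
  rw [add_zero, Complex.mul_conj, Complex.normSq_eq_norm_sq]

theorem summable_div_norm_dualPt_sq {f : (Fin 3 → ℤ) → ℝ} (hf : Summable f) :
    Summable fun m => f m / ‖dualPt m‖ ^ 2 := by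
  refine Summable.of_norm_bounded hf.norm fun m => ?_
  rw [norm_div, norm_pow, norm_norm, div_eq_mul_inv]
  exact mul_le_of_le_one_right (norm_nonneg _) (inv_norm_dualPt_sq_le_one m)

theorem summable_sub_corr_sq (e : ℝ) {s a : (Fin 3 → ℤ) → ℂ} (hs : Summable fun m => ‖s m‖ ^ 2)
    (ha : H1Seq a) : Summable fun m => ‖s m - e * corr a m‖ ^ 2 := by
  refine summable_norm_sub_sq hs ?_
  simp only [norm_mul, mul_pow]
  exact ha.summable_corr_sq.mul_left _

theorem kinetic_le_seqEnergy (e : ℝ) (s a : (Fin 3 → ℤ) → ℂ) :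
    ∑' m, ‖dualPt m‖ ^ 2 * ‖a m‖ ^ 2 ≤ seqEnergy e s a :=
  le_add_of_nonneg_right (tsum_nonneg fun m => by positivity)

theorem hasSum_seqEnergy (e : ℝ) {s a : (Fin 3 → ℤ) → ℂ} (hs : Summable fun m => ‖s m‖ ^ 2)
    (ha : H1Seq a) : HasSum (fun m => ‖dualPt m‖ ^ 2 * ‖a m‖ ^ 2 +
      ‖s m - e * corr a m‖ ^ 2 / ‖dualPt m‖ ^ 2) (seqEnergy e s a) :=
  ha.summable_norm_dualPt_sq.hasSum.add
    (summable_div_norm_dualPt_sq (summable_sub_corr_sq e hs ha)).hasSum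

/-- The energy is a supremum of finite partial sums with nonnegative terms, each continuous on the
ball because correlations are. -/
theorem lowerSemicontinuousOn_seqEnergy (e B : ℝ) {s : (Fin 3 → ℤ) → ℂ}
    (hs : Summable fun m => ‖s m‖ ^ 2) : LowerSemicontinuousOn (seqEnergy e s) (h1Ball B) := by
  intro a ha y hy
  have h := hasSum_seqEnergy e hs ha.1
  obtain ⟨t, ht⟩ := (h.eventually (lt_mem_nhds hy)).exists
  have hc : ContinuousOn (fun a => ∑ m ∈ t, (‖dualPt m‖ ^ 2 * ‖a m‖ ^ 2 +
      ‖s m - e * corr a m‖ ^ 2 / ‖dualPt m‖ ^ 2)) (h1Ball B) := by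
    refine continuousOn_finsetSum t fun m _ => ContinuousOn.add ?_ ?_
    · exact Continuous.continuousOn (by fun_prop)
    · exact ((continuousOn_const.sub (continuousOn_const.mul
        (continuousOn_corr B m))).norm.pow 2).div_const _
  filter_upwards [(hc a ha).eventually (lt_mem_nhds ht), self_mem_nhdsWithin] with b hb hbB
  exact hb.trans_le (sum_le_hasSum t (fun m _ => by positivity) (hasSum_seqEnergy e hs hbB.1))

/-- The direct method: the energy attains its minimum. -/
theorem exists_seqEnergy_minimizer (e : ℝ) {Z : ℝ} (hZ : 0 < Z) {s : (Fin 3 → ℤ) → ℂ}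
    (hs : Summable fun m => ‖s m‖ ^ 2) : ∃ a, H1Seq a ∧ ∑' m, ‖a m‖ ^ 2 = Z ∧
      ∀ b, H1Seq b → ∑' m, ‖b m‖ ^ 2 = Z → seqEnergy e s a ≤ seqEnergy e s b := by
  set E₀ := seqEnergy e s (constSeq Z) with hE₀
  -- The charge constraint is written as the zero mode of the correlation, which is continuous on
  -- the ball; hence no mass is lost in the limit. The radius bounds the H¹ norm of any competitor
  -- with energy at most E₀.
  set K := h1Ball (Z + E₀) ∩ (fun a => corr a 0) ⁻¹' {(Z : ℂ)} with hK
  have hKc : IsCompact K := (isCompact_h1Ball _).of_isClosed_subset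
    ((continuousOn_corr _ 0).preimage_isClosed_of_isClosed (isClosed_h1Ball _) isClosed_singleton)
    Set.inter_subset_left
  have hmem : ∀ b, H1Seq b → ∑' m, ‖b m‖ ^ 2 = Z → seqEnergy e s b ≤ E₀ → b ∈ K := by
    intro b hb hbZ hbE
    refine ⟨⟨hb, ?_⟩, ?_⟩
    · rw [hb.h1Sq_eq, hbZ]
      linarith [kinetic_le_seqEnergy e s b]
    · simp [corr_zero, hbZ]
  have hconst := hmem _ (h1Seq_constSeq Z) (tsum_norm_constSeq_sq hZ.le) le_rfl
  obtain ⟨a, haK, hmin⟩ := ((lowerSemicontinuousOn_seqEnergy e (Z + E₀) hs).mono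
    Set.inter_subset_left).exists_isMinOn ⟨_, hconst⟩ hKc
  have haZ : ∑' m, ‖a m‖ ^ 2 = Z := by
    have := haK.2
    simp only [corr_zero, Set.mem_preimage, Set.mem_singleton_iff] at this
    exact_mod_cast this
  refine ⟨a, haK.1.1, haZ, fun b hb hbZ => ?_⟩
  by_cases hbE : seqEnergy e s b ≤ E₀
  · exact hmin (hmem b hb hbZ hbE)
  · exact (hmin hconst).trans (not_le.1 hbE).le

/-! ### The diamagnetic inequality -/

/-- The shift of the torus by `τ` in the direction `j`. -/
noncomputable def axisShift (j : Fin 3) (τ : ℝ) : T3 := Pi.single j (τ : UnitAddCircle)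

theorem mFourier_axisShift (m : Fin 3 → ℤ) (j : Fin 3) (τ : ℝ) :
    mFourier m (axisShift j τ) = Complex.exp (Complex.I * ((dualPt m j * τ : ℝ) : ℂ)) := by
  rw [mFourier, ContinuousMap.coe_mk, Finset.prod_eq_single j]
  · rw [axisShift, Pi.single_eq_same, fourier_coe_apply]
    congr 1
    simp [dualPt]
    ring
  · intro i _ hi
    rw [axisShift, Pi.single_eq_of_ne hi, fourier_eval_zero]
  · simp

theorem norm_mFourier_axisShift_sub_one_le (m : Fin 3 → ℤ) (j : Fin 3) (τ : ℝ) :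
    ‖mFourier m (axisShift j τ) - 1‖ ≤ |τ| * |dualPt m j| := by
  rw [mFourier_axisShift]
  refine (Real.norm_exp_I_mul_ofReal_sub_one_le).trans_eq ?_
  rw [Real.norm_eq_abs, abs_mul, mul_comm]

theorem tendsto_norm_mFourier_axisShift (m : Fin 3 → ℤ) (j : Fin 3) :
    Tendsto (fun τ : ℝ => ‖mFourier m (axisShift j τ) - 1‖ ^ 2 / τ ^ 2) (𝓝[≠] 0)
      (𝓝 (dualPt m j ^ 2)) := by
  have h : HasDerivAt (fun τ : ℝ => Complex.exp (Complex.I * ((dualPt m j * τ : ℝ) : ℂ)))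
      (Complex.exp (Complex.I * ((dualPt m j * 0 : ℝ) : ℂ)) *
        (Complex.I * ((dualPt m j * 1 : ℝ) : ℂ))) 0 :=
    (((hasDerivAt_id (0 : ℝ)).const_mul (dualPt m j)).ofReal_comp.const_mul Complex.I).cexp
  have h2 := ((hasDerivAt_iff_tendsto_slope.1 h).norm).pow 2
  have e1 : ‖Complex.exp (Complex.I * ((dualPt m j * 0 : ℝ) : ℂ)) *
        (Complex.I * ((dualPt m j * 1 : ℝ) : ℂ))‖ ^ 2 = dualPt m j ^ 2 := by
    simp
  rw [e1] at h2
  refine h2.congr fun τ => ?_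
  rw [slope_def_module, norm_smul, mul_pow, mFourier_axisShift]
  simp [div_eq_inv_mul]

theorem norm_dualPt_sq_eq_sum (m : Fin 3 → ℤ) : ‖dualPt m‖ ^ 2 = ∑ j, dualPt m j ^ 2 :=
  EuclideanSpace.real_norm_sq_eq _

theorem H1Seq.summable_axis {a : (Fin 3 → ℤ) → ℂ} (ha : H1Seq a) (j : Fin 3) :
    Summable fun m => dualPt m j ^ 2 * ‖a m‖ ^ 2 :=
  Summable.of_nonneg_of_le (fun m => by positivity) (fun m => by
    rw [norm_dualPt_sq_eq_sum]
    gcongr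
    exact Finset.single_le_sum (fun i _ => sq_nonneg (dualPt m i)) (Finset.mem_univ j))
    ha.summable_norm_dualPt_sq

/-- Parseval for a difference. It characterizes derivatives by difference quotients, to which the
pointwise reverse triangle inequality applies. -/
theorem hasSum_norm_sq_coeff_shift_sub {f : T3 → ℂ} (hf : MemLp f 2 torusMeasure) (h : T3) :
    HasSum (fun m => ‖mFourier m h - 1‖ ^ 2 * ‖coeff f m‖ ^ 2)
      (∫ t, ‖f (t + h) - f t‖ ^ 2 ∂torusMeasure) := by
  have hfh : MemLp (fun t => f (t + h)) 2 torusMeasure :=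
    hf.comp_measurePreserving (measurePreserving_add_right torusMeasure h)
  have := hasSum_norm_sq_coeff (hfh.sub hf)
  refine this.congr_fun fun m => ?_
  have e : coeff ((fun t => f (t + h)) - f) m = coeff (fun t => f (t + h) - f t) m := rfl
  rw [e, coeff_sub (hfh.integrable one_le_two) (hf.integrable one_le_two), coeff_comp_add,
    ← mul_pow, ← norm_mul, sub_mul, one_mul]

/-- The diamagnetic inequality in one direction, for partial sums. -/
theorem sum_axis_coeff_norm_le {f : T3 → ℂ} (hf : MemH1 f) (j : Fin 3)
    (s : Finset (Fin 3 → ℤ)) :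
    ∑ m ∈ s, dualPt m j ^ 2 * ‖coeff (fun t => ((‖f t‖ : ℝ) : ℂ)) m‖ ^ 2 ≤
      ∑' m, dualPt m j ^ 2 * ‖coeff f m‖ ^ 2 := by
  have hn : MemLp (fun t => ((‖f t‖ : ℝ) : ℂ)) 2 torusMeasure := hf.1.norm.ofReal
  have hlim : Tendsto (fun τ : ℝ => ∑ m ∈ s, ‖mFourier m (axisShift j τ) - 1‖ ^ 2 / τ ^ 2 *
      ‖coeff (fun t => ((‖f t‖ : ℝ) : ℂ)) m‖ ^ 2) (𝓝[≠] 0)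
      (𝓝 (∑ m ∈ s, dualPt m j ^ 2 * ‖coeff (fun t => ((‖f t‖ : ℝ) : ℂ)) m‖ ^ 2)) :=
    tendsto_finsetSum _ fun m _ => (tendsto_norm_mFourier_axisShift m j).mul_const _
  -- The inequality is proved for difference quotients with step τ ≠ 0; the finite sum allows τ → 0.
  refine le_of_tendsto hlim ?_
  filter_upwards [self_mem_nhdsWithin] with τ hτ
  have hτ2 : 0 < τ ^ 2 := by
    have : τ ≠ 0 := hτ
    positivity
  have h1 := hasSum_norm_sq_coeff_shift_sub hn (axisShift j τ)
  have h2 := hasSum_norm_sq_coeff_shift_sub hf.1 (axisShift j τ)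
  have hle : ∫ t, ‖((‖f (t + axisShift j τ)‖ : ℝ) : ℂ) - ((‖f t‖ : ℝ) : ℂ)‖ ^ 2 ∂torusMeasure ≤
      ∫ t, ‖f (t + axisShift j τ) - f t‖ ^ 2 ∂torusMeasure := by
    have hfh : MemLp (fun t => f (t + axisShift j τ)) 2 torusMeasure :=
      hf.1.comp_measurePreserving (measurePreserving_add_right torusMeasure _)
    have hd := hfh.sub hf.1
    refine integral_mono_of_nonneg (Eventually.of_forall fun t => by positivity)
      ((memLp_two_iff_integrable_sq_norm hd.1).1 hd) (Eventually.of_forall fun t => ?_)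
    simp only [← Complex.ofReal_sub, Complex.norm_real]
    gcongr
    exact abs_norm_sub_norm_le _ _
  have h3 : ∑ m ∈ s, ‖mFourier m (axisShift j τ) - 1‖ ^ 2 *
      ‖coeff (fun t => ((‖f t‖ : ℝ) : ℂ)) m‖ ^ 2 ≤
      τ ^ 2 * ∑' m, dualPt m j ^ 2 * ‖coeff f m‖ ^ 2 := by
    refine (sum_le_hasSum s (fun m _ => by positivity) h1).trans (hle.trans ?_)
    rw [← tsum_mul_left]
    refine hasSum_le (fun m => ?_) h2 ((hf.h1Seq.summable_axis j).mul_left (τ ^ 2)).hasSum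
    rw [← mul_assoc]
    gcongr
    rw [← sq_abs τ, ← sq_abs (dualPt m j), ← mul_pow]
    gcongr
    exact norm_mFourier_axisShift_sub_one_le m j τ
  calc _ = (∑ m ∈ s, ‖mFourier m (axisShift j τ) - 1‖ ^ 2 *
      ‖coeff (fun t => ((‖f t‖ : ℝ) : ℂ)) m‖ ^ 2) / τ ^ 2 := by
        rw [Finset.sum_div]
        exact Finset.sum_congr rfl fun m _ => by ring
    _ ≤ _ := (div_le_iff₀ hτ2).2 (by linarith)

/-- The diamagnetic inequality `‖∇|f|‖ ≤ ‖∇f‖`. -/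
theorem MemH1.norm {f : T3 → ℂ} (hf : MemH1 f) : MemH1 (fun t => ((‖f t‖ : ℝ) : ℂ)) ∧
    ∑' m, ‖dualPt m‖ ^ 2 * ‖coeff (fun t => ((‖f t‖ : ℝ) : ℂ)) m‖ ^ 2 ≤
      ∑' m, ‖dualPt m‖ ^ 2 * ‖coeff f m‖ ^ 2 := by
  have hn : MemLp (fun t => ((‖f t‖ : ℝ) : ℂ)) 2 torusMeasure := hf.1.norm.ofReal
  have hle : ∀ s : Finset (Fin 3 → ℤ),
      ∑ m ∈ s, ‖dualPt m‖ ^ 2 * ‖coeff (fun t => ((‖f t‖ : ℝ) : ℂ)) m‖ ^ 2 ≤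
      ∑' m, ‖dualPt m‖ ^ 2 * ‖coeff f m‖ ^ 2 := by
    intro s
    have h := Finset.sum_le_sum fun j (_ : j ∈ Finset.univ) => sum_axis_coeff_norm_le hf j s
    rw [← Summable.tsum_finsetSum fun j _ => hf.h1Seq.summable_axis j, Finset.sum_comm] at h
    simpa only [← Finset.sum_mul, ← norm_dualPt_sq_eq_sum] using h
  have hs := summable_of_sum_le (fun m => by positivity) hle
  refine ⟨⟨hn, ?_⟩, hs.tsum_le_of_sum_le hle⟩
  simp only [add_mul, one_mul]
  exact (summable_coeff_sq hn).add hs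

/-! ### First variation and the Schrödinger equation -/

/-- The sequence with a single entry `c`, at `k`. -/
noncomputable def mode (k : Fin 3 → ℤ) (c : ℂ) (m : Fin 3 → ℤ) : ℂ := if m = k then c else 0

theorem mode_self (k : Fin 3 → ℤ) (c : ℂ) : mode k c k = c := if_pos rfl

theorem mode_of_ne {k m : Fin 3 → ℤ} (h : m ≠ k) (c : ℂ) : mode k c m = 0 := if_neg h

/-- The Coulomb form `∑_{m ≠ 0} Re (conj (f m) g m) / |2πm|²`. -/
noncomputable def coulomb (f g : (Fin 3 → ℤ) → ℂ) : ℝ :=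
  ∑' m, (conj (f m) * g m).re / ‖dualPt m‖ ^ 2

theorem summable_coulomb {f g : (Fin 3 → ℤ) → ℂ} (hf : Summable fun m => ‖f m‖ ^ 2)
    (hg : Summable fun m => ‖g m‖ ^ 2) :
    Summable fun m => (conj (f m) * g m).re / ‖dualPt m‖ ^ 2 := by
  refine summable_div_norm_dualPt_sq (Summable.of_norm_bounded (summable_mul_of_sq hf hg)
    fun m => ?_)
  simpa using Complex.abs_re_le_norm (conj (f m) * g m)

theorem hasSum_coulomb {f g : (Fin 3 → ℤ) → ℂ} (hf : Summable fun m => ‖f m‖ ^ 2)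
    (hg : Summable fun m => ‖g m‖ ^ 2) :
    HasSum (fun m => (conj (f m) * g m).re / ‖dualPt m‖ ^ 2) (coulomb f g) :=
  (summable_coulomb hf hg).hasSum

theorem coulomb_self (f : (Fin 3 → ℤ) → ℂ) : coulomb f f = ∑' m, ‖f m‖ ^ 2 / ‖dualPt m‖ ^ 2 := by
  refine tsum_congr fun m => ?_
  rw [mul_comm, Complex.mul_conj, Complex.ofReal_re, Complex.normSq_eq_norm_sq]

theorem coulomb_quadratic {X Y V : (Fin 3 → ℤ) → ℂ} (hX : Summable fun m => ‖X m‖ ^ 2)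
    (hY : Summable fun m => ‖Y m‖ ^ 2) (hV : Summable fun m => ‖V m‖ ^ 2) (t : ℝ) :
    ∑' m, ‖X m + t * Y m + t ^ 2 * V m‖ ^ 2 / ‖dualPt m‖ ^ 2 =
      coulomb X X + t * (2 * coulomb X Y) + t ^ 2 * (coulomb Y Y + 2 * coulomb X V) +
        t ^ 3 * (2 * coulomb Y V) + t ^ 4 * coulomb V V := by
  have h := ((((hasSum_coulomb hX hX).add ((hasSum_coulomb hX hY).mul_left (t * 2))).add
    (((hasSum_coulomb hY hY).add ((hasSum_coulomb hX hV).mul_left 2)).mul_left (t ^ 2))).add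
    ((hasSum_coulomb hY hV).mul_left (t ^ 3 * 2))).add ((hasSum_coulomb hV hV).mul_left (t ^ 4))
  simp only [← mul_assoc] at h ⊢
  rw [← h.tsum_eq]
  refine tsum_congr fun m => ?_
  rw [← Complex.normSq_eq_norm_sq, Complex.normSq_apply]
  simp only [Complex.add_re, Complex.add_im, Complex.mul_re, Complex.mul_im, Complex.conj_re,
    Complex.conj_im, ← Complex.ofReal_pow, Complex.ofReal_re, Complex.ofReal_im]
  ring

theorem coulomb_sub_right {f g h : (Fin 3 → ℤ) → ℂ} (c : ℝ) (d : ℝ)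
    (hf : Summable fun m => ‖f m‖ ^ 2) (hg : Summable fun m => ‖g m‖ ^ 2)
    (hh : Summable fun m => ‖h m‖ ^ 2) :
    coulomb f (fun m => c * g m - d * h m) = c * coulomb f g - d * coulomb f h := by
  have h1 := ((hasSum_coulomb hf hg).mul_left c).sub
    ((hasSum_coulomb hf hh).mul_left d)
  rw [← h1.tsum_eq]
  refine tsum_congr fun m => ?_
  simp only [Complex.mul_re, Complex.sub_re, Complex.sub_im, Complex.mul_im, Complex.ofReal_re,
    Complex.ofReal_im]
  ring

theorem summable_const_mul_sq {ι : Type*} {f : ι → ℂ} (c : ℂ) (hf : Summable fun m => ‖f m‖ ^ 2) :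
    Summable fun m => ‖c * f m‖ ^ 2 := by
  simp only [norm_mul, mul_pow]
  exact hf.mul_left _

theorem H1Seq.const_mul {a : (Fin 3 → ℤ) → ℂ} (ha : H1Seq a) (c : ℂ) :
    H1Seq fun m => c * a m := by
  unfold H1Seq
  simp only [norm_mul, mul_pow, mul_left_comm _ (‖c‖ ^ 2)]
  exact Summable.mul_left _ ha

theorem H1Seq.add_single {a : (Fin 3 → ℤ) → ℂ} (ha : H1Seq a) (c : ℂ) (k : Fin 3 → ℤ) :
    H1Seq fun m => a m + mode k c m := by
  have h : Summable fun m => weight m * ‖mode k c m‖ ^ 2 :=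
    summable_of_ne_finset_zero (s := {k}) fun m hm => by
      rw [mode_of_ne (by simpa using hm)]; simp
  refine Summable.of_nonneg_of_le (fun m => mul_nonneg (weight_nonneg m) (sq_nonneg _))
    (fun m => ?_) ((Summable.add ha h).mul_left 2)
  have hw := weight_nonneg m
  have h2 : ‖a m + mode k c m‖ ^ 2 ≤
      2 * (‖a m‖ ^ 2 + ‖mode k c m‖ ^ 2) := by
    have := norm_add_le (a m) (mode k c m)
    nlinarith [norm_nonneg (a m + mode k c m),
      sq_nonneg (‖a m‖ - ‖mode k c m‖)]
  nlinarith [mul_le_mul_of_nonneg_left h2 hw]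

theorem norm_add_sq_complex (z w : ℂ) :
    ‖z + w‖ ^ 2 = ‖z‖ ^ 2 + 2 * (conj w * z).re + ‖w‖ ^ 2 := by
  simp only [← Complex.normSq_eq_norm_sq, Complex.normSq_apply, Complex.add_re, Complex.add_im,
    Complex.mul_re, Complex.conj_re, Complex.conj_im]
  ring

theorem tsum_mul_norm_add_single_sq {w : (Fin 3 → ℤ) → ℝ} {a : (Fin 3 → ℤ) → ℂ}
    (ha : Summable fun m => w m * ‖a m‖ ^ 2) (c : ℂ) (k : Fin 3 → ℤ) :
    ∑' m, w m * ‖a m + mode k c m‖ ^ 2 =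
      (∑' m, w m * ‖a m‖ ^ 2) + w k * (2 * (conj c * a k).re + ‖c‖ ^ 2) := by
  have h := ha.hasSum.add (hasSum_ite_eq k (w k * (2 * (conj c * a k).re + ‖c‖ ^ 2)))
  rw [← h.tsum_eq]
  refine tsum_congr fun m => ?_
  by_cases hm : m = k
  · subst hm
    simp only [mode_self, if_true, norm_add_sq_complex]
    ring
  · simp [hm, mode_of_ne]

/-- Only the indices j = k and j = k - m see the perturbation; they coincide exactly for m = 0,
which produces the quadratic term. -/
theorem corr_add_single {a : (Fin 3 → ℤ) → ℂ} (ha : Summable fun m => ‖a m‖ ^ 2) (c : ℂ)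
    (k m : Fin 3 → ℤ) : corr (fun m => a m + mode k c m) m =
      corr a m + (conj c * a (m + k) + c * conj (a (k - m))) +
        mode 0 ((‖c‖ ^ 2 : ℝ) : ℂ) m := by
  have h := ((hasSum_corr ha ha m).add
    ((hasSum_ite_eq k (conj c * a (m + k))).add (hasSum_ite_eq (k - m) (c * conj (a (k - m)))))).add
    (hasSum_ite_eq k (mode 0 ((‖c‖ ^ 2 : ℝ) : ℂ) m))
  rw [← corr] at h
  rw [← h.tsum_eq, corr]
  refine tsum_congr fun j => ?_
  have e1 : mode k c (j + m) = if j = k - m then c else 0 := by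
    rw [mode]
    simp only [eq_sub_iff_add_eq]
  rw [e1, mode, mode, Complex.ofReal_pow, ← Complex.mul_conj']
  by_cases h1 : j = k <;> by_cases h2 : m = 0
  · subst h1; subst h2; simp; ring
  · subst h1
    have h3 : j ≠ j - m := fun h => h2 (sub_eq_self.1 h.symm)
    simp only [if_neg h3, if_neg h2, if_true, map_add, add_comm m j]
    ring
  · subst h2; simp [h1]
  · by_cases h3 : j = k - m
    · simp [h2, h3]; ring
    · simp [h1, h3]

theorem corr_const_mul (c : ℂ) (a : (Fin 3 → ℤ) → ℂ) (m : Fin 3 → ℤ) :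
    corr (fun m => c * a m) m = ((‖c‖ ^ 2 : ℝ) : ℂ) * corr a m := by
  rw [corr, corr, ← tsum_mul_left]
  refine tsum_congr fun k => ?_
  rw [Complex.ofReal_pow, ← Complex.mul_conj', map_mul]
  ring

/-- A polynomial of degree four which is nonnegative near zero and vanishes at zero has no linear
term. -/
theorem linear_coeff_eq_zero {c₁ c₂ c₃ c₄ : ℝ}
    (h : ∀ᶠ t : ℝ in 𝓝 0, 0 ≤ c₁ * t + c₂ * t ^ 2 + c₃ * t ^ 3 + c₄ * t ^ 4) : c₁ = 0 := by
  have hd : HasDerivAt (fun t : ℝ => c₁ * t + c₂ * t ^ 2 + c₃ * t ^ 3 + c₄ * t ^ 4) c₁ 0 := by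
    have := ((((hasDerivAt_id (0 : ℝ)).const_mul c₁).add
      (((hasDerivAt_id (0 : ℝ)).pow 2).const_mul c₂)).add
      (((hasDerivAt_id (0 : ℝ)).pow 3).const_mul c₃)).add
      (((hasDerivAt_id (0 : ℝ)).pow 4).const_mul c₄)
    simpa using! this
  exact IsLocalMin.hasDerivAt_eq_zero (by filter_upwards [h] with t ht; simpa using ht) hd

theorem seqEnergy_eq (e : ℝ) (s a : (Fin 3 → ℤ) → ℂ) : seqEnergy e s a =
    (∑' m, ‖dualPt m‖ ^ 2 * ‖a m‖ ^ 2) +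
      coulomb (fun m => s m - e * corr a m) (fun m => s m - e * corr a m) := by
  rw [coulomb_self, seqEnergy]

/-- The minimization property in homogeneous form. -/
theorem seqEnergy_min_homogeneous {e Z : ℝ} {s a : (Fin 3 → ℤ) → ℂ}
    (hmin : ∀ b, H1Seq b → ∑' m, ‖b m‖ ^ 2 = Z → seqEnergy e s a ≤ seqEnergy e s b)
    {b : (Fin 3 → ℤ) → ℂ} (hb : H1Seq b) {l : ℝ} (hl : 0 < l) (hbl : ∑' m, ‖b m‖ ^ 2 = l * Z) :
    l ^ 2 * seqEnergy e s a ≤ l * (∑' m, ‖dualPt m‖ ^ 2 * ‖b m‖ ^ 2) +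
      ∑' m, ‖l * s m - e * corr b m‖ ^ 2 / ‖dualPt m‖ ^ 2 := by
  have hc : ‖((√l)⁻¹ : ℂ)‖ ^ 2 = l⁻¹ := by
    rw [norm_inv, Complex.norm_real, inv_pow, Real.norm_eq_abs, sq_abs, Real.sq_sqrt hl.le]
  -- Dividing `b` by √l restores the charge Z; multiplying the energy by l² then clears all
  -- denominators, so that perturbations give polynomials.
  have h := hmin (fun m => ((√l)⁻¹ : ℂ) * b m) (hb.const_mul _) (by
    simp only [norm_mul, mul_pow, hc]
    rw [tsum_mul_left, hbl, inv_mul_cancel_left₀ hl.ne'])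
  refine (mul_le_mul_of_nonneg_left h (sq_nonneg l)).trans_eq ?_
  rw [seqEnergy, mul_add, ← tsum_mul_left, ← tsum_mul_left, ← tsum_mul_left]
  congr 1
  · refine tsum_congr fun m => ?_
    rw [norm_mul, mul_pow, hc]
    field_simp
  · refine tsum_congr fun m => ?_
    rw [corr_const_mul, hc, ← mul_div_assoc]
    congr 1
    have : (l : ℂ) * s m - e * corr b m = (l : ℂ) * (s m - e * (((l⁻¹ : ℝ) : ℂ) * corr b m)) := by
      have hl' : (l : ℂ) ≠ 0 := by exact_mod_cast hl.ne'
      push_cast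
      field_simp
    rw [this, norm_mul, mul_pow, Complex.norm_real, Real.norm_eq_abs, sq_abs]

/-- The first variation of the energy at a minimizer. -/
theorem first_variation {e Z : ℝ} (hZ : 0 < Z) {s a : (Fin 3 → ℤ) → ℂ}
    (hs : Summable fun m => ‖s m‖ ^ 2) (ha : H1Seq a) (haZ : ∑' m, ‖a m‖ ^ 2 = Z)
    (hmin : ∀ b, H1Seq b → ∑' m, ‖b m‖ ^ 2 = Z → seqEnergy e s a ≤ seqEnergy e s b)
    (c : ℂ) (k : Fin 3 → ℤ) :
    ‖dualPt k‖ ^ 2 * (conj c * a k).re - e * coulomb (fun m => s m - e * corr a m)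
        (fun m => conj c * a (m + k) + c * conj (a (k - m))) =
      ((∑' m, ‖dualPt m‖ ^ 2 * ‖a m‖ ^ 2) -
        2 * e * coulomb (fun m => s m - e * corr a m) (corr a)) / Z * (conj c * a k).re := by
  set x := (conj c * a k).re with hx
  set K := ∑' m, ‖dualPt m‖ ^ 2 * ‖a m‖ ^ 2 with hK
  set X : (Fin 3 → ℤ) → ℂ := fun m => s m - e * corr a m with hX
  set R : (Fin 3 → ℤ) → ℂ := fun m => conj c * a (m + k) + c * conj (a (k - m)) with hR
  set S : (Fin 3 → ℤ) → ℂ := mode 0 ((‖c‖ ^ 2 : ℝ) : ℂ) with hS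
  have hXs : Summable fun m => ‖X m‖ ^ 2 := summable_sub_corr_sq e hs ha
  have hPs := ha.summable_corr_sq
  have hRs : Summable fun m => ‖R m‖ ^ 2 := by
    have h1 := summable_const_mul_sq (conj c)
      (f := fun m => a (m + k)) (summable_shift ha.summable_sq k)
    have h2 : Summable fun m => ‖-c * conj (a (k - m))‖ ^ 2 := by
      refine summable_const_mul_sq (-c) ?_
      simp only [RCLike.norm_conj]
      exact ha.summable_sq.comp_injective (sub_right_injective (b := k))
    simpa [hR] using summable_norm_sub_sq h1 h2
  have hSs : Summable fun m => ‖S m‖ ^ 2 :=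
    summable_of_ne_finset_zero (s := {0}) fun m hm => by
      rw [hS, mode_of_ne (by simpa using hm)]; simp
  -- The charge of the sequence `a` perturbed by t·c in mode k is (1 + tα + t²β)Z.
  set α := 2 * x / Z with hα
  set β := ‖c‖ ^ 2 / Z with hβ
  set Y : (Fin 3 → ℤ) → ℂ := fun m => α * s m - e * R m with hY
  set V : (Fin 3 → ℤ) → ℂ := fun m => β * s m - e * S m with hV
  have hYs : Summable fun m => ‖Y m‖ ^ 2 :=
    summable_norm_sub_sq (summable_const_mul_sq _ hs) (summable_const_mul_sq _ hRs)
  have hVs : Summable fun m => ‖V m‖ ^ 2 :=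
    summable_norm_sub_sq (summable_const_mul_sq _ hs) (summable_const_mul_sq _ hSs)
  have hXY : coulomb X Y = α * coulomb X s - e * coulomb X R := coulomb_sub_right α e hXs hs hRs
  have hXX : coulomb X X = coulomb X s - e * coulomb X (corr a) := by
    have := coulomb_sub_right 1 e hXs hs hPs
    simpa [hX] using this
  have hE : seqEnergy e s a = K + coulomb X X := seqEnergy_eq e s a
  have hpos : ∀ᶠ t : ℝ in 𝓝 0, 0 < 1 + t * α + t ^ 2 * β := by
    have hc : ContinuousAt (fun t : ℝ => 1 + t * α + t ^ 2 * β) 0 := by fun_prop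
    exact hc.eventually (lt_mem_nhds (by norm_num))
  -- The homogeneous inequality with l = 1 + tα + t²β, sorted by powers of t. Only the linear
  -- coefficient matters afterwards.
  have hmain : ∀ᶠ t : ℝ in 𝓝 0, 0 ≤
      (α * K + 2 * ‖dualPt k‖ ^ 2 * x + 2 * coulomb X Y - 2 * α * (K + coulomb X X)) * t +
      (β * K + α * (2 * ‖dualPt k‖ ^ 2 * x) + ‖dualPt k‖ ^ 2 * ‖c‖ ^ 2 +
        (coulomb Y Y + 2 * coulomb X V) - (α ^ 2 + 2 * β) * (K + coulomb X X)) * t ^ 2 +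
      (α * (‖dualPt k‖ ^ 2 * ‖c‖ ^ 2) + β * (2 * ‖dualPt k‖ ^ 2 * x) + 2 * coulomb Y V -
        2 * α * β * (K + coulomb X X)) * t ^ 3 +
      (β * (‖dualPt k‖ ^ 2 * ‖c‖ ^ 2) + coulomb V V - β ^ 2 * (K + coulomb X X)) * t ^ 4 := by
    filter_upwards [hpos] with t ht
    have hx' : (conj ((t : ℂ) * c) * a k).re = t * x := by
      rw [map_mul, Complex.conj_ofReal, mul_assoc, Complex.re_ofReal_mul]
    have hn : ‖(t : ℂ) * c‖ ^ 2 = t ^ 2 * ‖c‖ ^ 2 := by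
      rw [norm_mul, mul_pow, Complex.norm_real, Real.norm_eq_abs, sq_abs]
    have hb := ha.add_single ((t : ℂ) * c) k
    have h1 : ∑' m, ‖a m + mode k ((t : ℂ) * c) m‖ ^ 2
        = (1 + t * α + t ^ 2 * β) * Z := by
      have := tsum_mul_norm_add_single_sq (w := fun _ => 1) (a := a)
        (by simpa using ha.summable_sq) ((t : ℂ) * c) k
      simp only [one_mul, haZ, hx', hn] at this
      rw [this, hα, hβ]
      field_simp
      ring
    have h2 := tsum_mul_norm_add_single_sq ha.summable_norm_dualPt_sq ((t : ℂ) * c) k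
    have h := seqEnergy_min_homogeneous hmin hb ht h1
    rw [h2, hx', hn, hE, ← hK] at h
    have h3 : ∑' m, ‖((1 + t * α + t ^ 2 * β : ℝ) : ℂ) * s m - e * corr
        (fun m => a m + mode k ((t : ℂ) * c) m) m‖ ^ 2 / ‖dualPt m‖ ^ 2 =
        ∑' m, ‖X m + t * Y m + t ^ 2 * V m‖ ^ 2 / ‖dualPt m‖ ^ 2 := by
      refine tsum_congr fun m => ?_
      congr 3
      rw [corr_add_single ha.summable_sq, hn]
      have hS' : mode 0 ((t ^ 2 * ‖c‖ ^ 2 : ℝ) : ℂ) m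
          = (t : ℂ) ^ 2 * S m := by
        rw [hS, mode, mode]
        split_ifs <;> simp
      rw [hS']
      simp only [hX, hY, hV, hR, map_mul, Complex.conj_ofReal]
      push_cast
      ring
    rw [h3, coulomb_quadratic hXs hYs hVs] at h
    linarith
  have h0 := linear_coeff_eq_zero hmain
  rw [hXY, hXX] at h0
  have : ‖dualPt k‖ ^ 2 * x - e * coulomb X R = α / 2 * (K - 2 * e * coulomb X (corr a)) := by
    linarith
  rw [this, hα]
  ring

/-- The Schrödinger equation for a real minimizer. -/
theorem schrodinger_of_minimal {e Z : ℝ} (hZ : 0 < Z) {s a : (Fin 3 → ℤ) → ℂ}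
    (hs : Summable fun m => ‖s m‖ ^ 2) (ha : H1Seq a) (haZ : ∑' m, ‖a m‖ ^ 2 = Z)
    (hmin : ∀ b, H1Seq b → ∑' m, ‖b m‖ ^ 2 = Z → seqEnergy e s a ≤ seqEnergy e s b)
    (hsr : ∀ m, s (-m) = conj (s m))
    (hcr : ∀ m, corr a (-m) = conj (corr a m)) :
    ∃ ω : ℝ, ∀ k g, HasSum (fun m => (s m - e * corr a m) / ((‖dualPt m‖ ^ 2 : ℝ) : ℂ) *
      a (k - m)) g → (ω : ℂ) * a k = (1 / 2 : ℂ) * ((‖dualPt k‖ ^ 2 : ℝ) : ℂ) * a k - e * g := by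
  -- The Lagrange multiplier read off from the first variation; the final factor 1/2 matches the ½
  -- in front of -Δ.
  refine ⟨((∑' m, ‖dualPt m‖ ^ 2 * ‖a m‖ ^ 2) -
        2 * e * coulomb (fun m => s m - e * corr a m) (corr a)) / Z / 2, fun k g hg => ?_⟩
  set ω := ((∑' m, ‖dualPt m‖ ^ 2 * ‖a m‖ ^ 2) -
        2 * e * coulomb (fun m => s m - e * corr a m) (corr a)) / Z / 2 with hω
  have key : ∀ c : ℂ, (conj c * ((1 / 2 : ℂ) * ((‖dualPt k‖ ^ 2 : ℝ) : ℂ) * a k - e * g -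
      ω * a k)).re = 0 := by
    intro c
    have h := first_variation hZ hs ha haZ hmin c k
    have hXr : ∀ m, s (-m) - e * corr a (-m) = conj (s m - e * corr a m) := by
      intro m
      rw [hsr, hcr, map_sub, map_mul, Complex.conj_ofReal]
    have g1 : HasSum (fun m => (conj c * ((s m - e * corr a m) * a (k - m))).re / ‖dualPt m‖ ^ 2)
        (conj c * g).re := by
      refine (Complex.hasSum_re (hg.mul_left (conj c))).congr_fun fun m => ?_
      rw [← Complex.div_ofReal_re]
      congr 1
      ring
    -- The substitution m ↦ -m together with reality of the charge density identifies this sum with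
    -- `g1`; for `g3` it suffices to conjugate. So both halves of the variation agree.
    have g2 : HasSum (fun m => (conj (s m - e * corr a m) * (conj c * a (m + k))).re /
        ‖dualPt m‖ ^ 2) (conj c * g).re := by
      refine ((Equiv.neg (Fin 3 → ℤ)).hasSum_iff.2 g1).congr_fun fun m => ?_
      simp only [Function.comp_apply, Equiv.neg_apply, hXr, norm_dualPt_neg, sub_neg_eq_add,
        add_comm k m]
      congr 2
      ring
    have g3 : HasSum (fun m => (conj (s m - e * corr a m) * (c * conj (a (k - m)))).re /
        ‖dualPt m‖ ^ 2) (conj c * g).re := by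
      refine g1.congr_fun fun m => ?_
      rw [← Complex.conj_re]
      congr 2
      simp only [map_mul, Complex.conj_conj]
      ring
    have hW : coulomb (fun m => s m - e * corr a m)
        (fun m => conj c * a (m + k) + c * conj (a (k - m))) = 2 * (conj c * g).re := by
      rw [two_mul, ← (g2.add g3).tsum_eq]
      refine tsum_congr fun m => ?_
      rw [mul_add, Complex.add_re, add_div]
    rw [hW] at h
    have e1 : conj c * ((1 / 2 : ℂ) * ((‖dualPt k‖ ^ 2 : ℝ) : ℂ) * a k - e * g - ω * a k) =
        ((1 / 2 * ‖dualPt k‖ ^ 2 - ω : ℝ) : ℂ) * (conj c * a k) - (e : ℂ) * (conj c * g) := by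
      push_cast
      ring
    rw [e1, Complex.sub_re, Complex.re_ofReal_mul, Complex.re_ofReal_mul]
    have h2 : 2 * ω = ((∑' m, ‖dualPt m‖ ^ 2 * ‖a m‖ ^ 2) -
        2 * e * coulomb (fun m => s m - e * corr a m) (corr a)) / Z := by rw [hω]; ring
    rw [← h2] at h
    linarith
  -- The residual itself is taken for c, so its squared modulus vanishes.
  have h := key ((1 / 2 : ℂ) * ((‖dualPt k‖ ^ 2 : ℝ) : ℂ) * a k - e * g - ω * a k)
  rw [mul_comm, Complex.mul_conj, Complex.ofReal_re, Complex.normSq_eq_zero] at h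
  exact (sub_eq_zero.1 h).symm

/-- Every ion density has a real ground state. -/
theorem exists_isRealGroundState {Z : ℝ} (hZ : 0 < Z) {μ : E3 → ℝ} (hμ : IsIonDensity Z μ) (e : ℝ) :
    ∃ (ψ : T3 → ℝ) (ω : ℝ), IsRealGroundState Z e (fun x => e * μ x) ψ ω := by
  have hσ := memLp_periodization_const_mul hμ e
  set s := coeff fun t => (periodization (fun x => e * μ x) t : ℂ) with hs
  have hss : Summable fun m => ‖s m‖ ^ 2 := summable_coeff_sq hσ.ofReal
  obtain ⟨a, ha, haZ, hmin⟩ := exists_seqEnergy_minimizer e hZ hss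
  obtain ⟨f, hf, rfl⟩ := exists_memH1_coeff_eq ha
  obtain ⟨hn, hK⟩ := hf.norm
  set ψ : T3 → ℝ := fun t => ‖f t‖ with hψ
  set b := coeff fun t => (ψ t : ℂ) with hb
  -- Passing from f to |f| leaves the density unchanged, hence also the charge and the Coulomb
  -- energy; only the kinetic energy can drop.
  have hbc : corr b = corr (coeff f) := by
    rw [← coeff_norm_sq hn.1, ← coeff_norm_sq hf.1]
    simp
  have hbZ : ∑' m, ‖b m‖ ^ 2 = Z := by
    have : corr b 0 = corr (coeff f) 0 := by rw [hbc]
    rw [corr_zero, corr_zero, haZ] at this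
    exact_mod_cast this
  have hbH : H1Seq b := hn.h1Seq
  have hbmin : ∀ d, H1Seq d → ∑' m, ‖d m‖ ^ 2 = Z → seqEnergy e s b ≤ seqEnergy e s d := by
    intro d hd hdZ
    refine le_trans ?_ (hmin d hd hdZ)
    rw [seqEnergy, seqEnergy, hbc]
    exact add_le_add_left hK _
  have hcr : ∀ m, corr b (-m) = conj (corr b m) := by
    intro m
    rw [hb, ← coeff_norm_sq hn.1]
    exact coeff_ofReal_neg _ m
  obtain ⟨ω, hω⟩ := schrodinger_of_minimal hZ hss hbH hbZ hbmin (coeff_ofReal_neg _) hcr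
  refine ⟨ψ, ω, mem_admissible_iff.2 ⟨hn, hbZ⟩, fun φ hφ => ?_, fun k => ?_⟩
  · obtain ⟨h1, h2⟩ := mem_admissible_iff.1 hφ
    rw [cellEnergy_eq_seqEnergy hσ hn, cellEnergy_eq_seqEnergy hσ h1]
    exact mul_le_mul_of_nonneg_left (hbmin _ h1.h1Seq h2) (by norm_num)
  · exact hω k _ (hasSum_coeff_potential_mul hσ hn (hn.1.integrable one_le_two) k)

/-! ### Gaussian ion densities -/

/-- The Gaussian `A e^{-b|x|²}`. -/
noncomputable def gaussian (A b : ℝ) (x : E3) : ℝ := A * Real.exp (-b * ‖x‖ ^ 2)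

theorem contDiff_gaussian (A b : ℝ) {n : WithTop ℕ∞} : ContDiff ℝ n (gaussian A b) :=
  contDiff_const.mul (Real.contDiff_exp.comp (contDiff_const.mul (contDiff_norm_sq ℝ)))

theorem integrable_exp_neg_mul_norm_sq {b : ℝ} (hb : 0 < b) :
    Integrable (fun x : E3 => Real.exp (-b * ‖x‖ ^ 2)) := by
  -- The integral of a nonintegrable function is 0 by convention, so the known nonzero value implies
  -- integrability.
  refine Integrable.of_integral_ne_zero ?_
  rw [GaussianFourier.integral_rexp_neg_mul_sq_norm hb]
  have : 0 < Real.pi / b := div_pos Real.pi_pos hb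
  exact (Real.rpow_pos_of_pos this _).ne'

theorem integrable_gaussian (A : ℝ) {b : ℝ} (hb : 0 < b) : Integrable (gaussian A b) :=
  (integrable_exp_neg_mul_norm_sq hb).const_mul A

theorem memLp_gaussian (A : ℝ) {b : ℝ} (hb : 0 < b) : MemLp (gaussian A b) 2 volume := by
  have hc : AEStronglyMeasurable (gaussian A b) volume :=
    (contDiff_gaussian A b (n := 0)).continuous.aestronglyMeasurable
  rw [memLp_two_iff_integrable_sq_norm hc]
  refine ((integrable_exp_neg_mul_norm_sq (by linarith : 0 < 2 * b)).const_mul (A ^ 2)).congr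
    (Eventually.of_forall fun x => ?_)
  simp only [gaussian, Real.norm_eq_abs, sq_abs, mul_pow, ← Real.exp_nat_mul]
  congr 2
  push_cast
  ring

theorem one_add_le_mul_exp {c y : ℝ} (hc : 0 < c) (hy : 0 ≤ y) :
    1 + y ≤ (1 + c⁻¹) * Real.exp (c * y) := by
  have h1 : 1 ≤ Real.exp (c * y) := Real.one_le_exp (by positivity)
  have h2 : c * y ≤ Real.exp (c * y) := by linarith [Real.add_one_le_exp (c * y)]
  have h3 : y ≤ c⁻¹ * Real.exp (c * y) := by
    rw [← div_eq_inv_mul, le_div_iff₀ hc]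
    linarith
  linarith

/-- Gaussians absorb polynomial factors of degree two. -/
theorem one_add_mul_gaussian_le {A b : ℝ} (hA : 0 ≤ A) (hb : 0 < b) (x : E3) :
    (1 + ‖x‖ ^ 2) * gaussian A b x ≤ gaussian ((1 + (b / 2)⁻¹) * A) (b / 2) x := by
  have h := mul_le_mul_of_nonneg_right (one_add_le_mul_exp (half_pos hb) (sq_nonneg ‖x‖))
    (mul_nonneg hA (Real.exp_pos (-b * ‖x‖ ^ 2)).le)
  refine h.trans_eq ?_
  have : Real.exp (-(b / 2) * ‖x‖ ^ 2)
      = Real.exp (b / 2 * ‖x‖ ^ 2) * Real.exp (-b * ‖x‖ ^ 2) := by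
    rw [← Real.exp_add]; congr 1; ring
  rw [gaussian, this]
  ring

theorem gaussian_nonneg {A : ℝ} (hA : 0 ≤ A) (b : ℝ) (x : E3) : 0 ≤ gaussian A b x :=
  mul_nonneg hA (Real.exp_pos _).le

theorem fourierT_gaussian (A : ℝ) {b : ℝ} (hb : 0 < b) (ξ : E3) :
    fourierT (gaussian A b) ξ =
      ((A * (Real.pi / b) ^ (3 / 2 : ℝ) * Real.exp (-(4 * b)⁻¹ * ‖ξ‖ ^ 2) : ℝ) : ℂ) := by
  have h := GaussianFourier.integral_cexp_neg_mul_sq_norm_add (V := E3) (b := (b : ℂ))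
    (by simpa using hb) Complex.I ξ
  have e1 : fourierT (gaussian A b) ξ = A * ∫ v : E3,
      Complex.exp (-b * ‖v‖ ^ 2 + Complex.I * (inner ℝ ξ v : ℝ)) := by
    rw [fourierT, ← integral_const_mul]
    congr 1 with x
    rw [Complex.exp_add, gaussian]
    push_cast
    ring
  rw [e1, h, ← mul_assoc]
  push_cast
  congr 2
  · rw [Complex.ofReal_cpow (by positivity)]
    simp
  · rw [Complex.I_sq]
    field_simp

theorem integral_gaussian (A : ℝ) {b : ℝ} (hb : 0 < b) :
    ∫ x, gaussian A b x = A * (Real.pi / b) ^ (3 / 2 : ℝ) := by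
  simp only [gaussian, integral_const_mul, GaussianFourier.integral_rexp_neg_mul_sq_norm hb]
  simp

/-- The sum of a Gaussian over a lattice converges. -/
theorem summable_exp_neg_mul_norm_dualPt_sq {c : ℝ} (hc : 0 < c) :
    Summable fun m : Fin 3 → ℤ => Real.exp (-c * ‖dualPt m‖ ^ 2) := by
  refine Summable.of_nonneg_of_le (fun _ => (Real.exp_pos _).le) (fun m => ?_)
    (summable_inv_weight_sq.mul_left ((1 + (c / 2)⁻¹) ^ 2))
  -- The rate c/2 is used because the estimate is squared to compare with weight⁻².
  have h := one_add_le_mul_exp (half_pos hc) (sq_nonneg ‖dualPt m‖)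
  have hw := weight_pos m
  change weight m ≤ _ at h
  have h2 := pow_le_pow_left₀ hw.le h 2
  rw [mul_pow, ← Real.exp_nat_mul] at h2
  have e : ((2 : ℕ) : ℝ) * (c / 2 * ‖dualPt m‖ ^ 2) = c * ‖dualPt m‖ ^ 2 := by push_cast; ring
  rw [e] at h2
  rw [neg_mul, Real.exp_neg, inv_pow, ← div_eq_mul_inv, le_div_iff₀ (by positivity),
    inv_mul_le_iff₀ (Real.exp_pos _)]
  linarith

theorem half_norm_sq_sub_le (u v : E3) : ‖u‖ ^ 2 / 2 - ‖v‖ ^ 2 ≤ ‖u - v‖ ^ 2 := by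
  have := norm_le_norm_sub_add u v
  have h : ‖u‖ ^ 2 ≤ (‖u - v‖ + ‖v‖) ^ 2 := by gcongr
  nlinarith [sq_nonneg (‖u - v‖ - ‖v‖)]

theorem memLp_periodization_gaussian {A b : ℝ} (hA : 0 ≤ A) (hb : 0 < b) :
    MemLp (periodization (gaussian A b)) 2 torusMeasure := by
  let r : T3 → (Fin 3 → ℤ) → E3 := fun t n =>
    WithLp.toLp 2 fun i => ((AddCircle.equivIco (1 : ℝ) 0 (t i) : ℝ) - (n i : ℝ))
  have hper : ∀ t, periodization (gaussian A b) t = ∑' n, gaussian A b (r t n) := fun t => rfl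
  -- Chosen so that c|2πn|² = b|n|²/2.
  set c := b * (1 / 2 / (2 * Real.pi) ^ 2) with hc
  have hc0 : 0 < c := by positivity
  have hle : ∀ t n, gaussian A b (r t n) ≤
      A * Real.exp (b * 3) * Real.exp (-c * ‖dualPt n‖ ^ 2) := by
    intro t n
    have h1 : ∑ i, (n i : ℝ) ^ 2 / 2 - 3 ≤ ‖r t n‖ ^ 2 := by
      rw [EuclideanSpace.real_norm_sq_eq]
      -- For 0 ≤ y < 1 one has (y - n)² - n²/2 + y² = (2y - n)²/2 ≥ 0.
      have h2 : ∀ i, (n i : ℝ) ^ 2 / 2 - 1 ≤ r t n i ^ 2 := by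
        intro i
        obtain ⟨h3, h4⟩ := (AddCircle.equivIco (1 : ℝ) 0 (t i)).2
        have h5 : r t n i = (AddCircle.equivIco (1 : ℝ) 0 (t i) : ℝ) - n i := rfl
        rw [h5]
        generalize (AddCircle.equivIco (1 : ℝ) 0 (t i) : ℝ) = y at *
        nlinarith [sq_nonneg (2 * y - n i)]
      have := Finset.sum_le_sum fun i (_ : i ∈ Finset.univ) => h2 i
      simpa using this
    rw [gaussian, mul_assoc, ← Real.exp_add]
    refine mul_le_mul_of_nonneg_left (Real.exp_le_exp.2 ?_) hA
    have h6 : c * ‖dualPt n‖ ^ 2 = b * ∑ i, (n i : ℝ) ^ 2 / 2 := by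
      rw [norm_dualPt_sq, ← Finset.sum_div, hc]
      field_simp
    nlinarith
  have hsum := (summable_exp_neg_mul_norm_dualPt_sq hc0).mul_left (A * Real.exp (b * 3))
  have hs : ∀ t, Summable fun n => gaussian A b (r t n) := fun t =>
    Summable.of_nonneg_of_le (fun _ => gaussian_nonneg hA _ _) (hle t) hsum
  have hmeas : Measurable (periodization (gaussian A b)) := by
    refine Measurable.tsum fun n => (contDiff_gaussian A b (n := 0)).continuous.measurable.comp ?_
    refine (MeasurableEquiv.toLp 2 (Fin 3 → ℝ)).measurable.comp (measurable_pi_lambda _ fun i => ?_)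
    exact (measurable_subtype_coe.comp ((AddCircle.measurableEquivIco 1 0).measurable.comp
      (measurable_pi_apply i))).sub_const _
  refine MemLp.of_bound hmeas.aestronglyMeasurable
    (∑' n, A * Real.exp (b * 3) * Real.exp (-c * ‖dualPt n‖ ^ 2)) (Eventually.of_forall fun t => ?_)
  rw [hper, Real.norm_of_nonneg (tsum_nonneg fun n => gaussian_nonneg hA _ _)]
  exact (hs t).tsum_le_tsum (hle t) hsum

theorem fderiv_gaussian (A b : ℝ) (x v : E3) :
    fderiv ℝ (gaussian A b) x v = -2 * b * inner ℝ x v * gaussian A b x := by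
  have h1 : HasFDerivAt (fun x : E3 => -b * ‖x‖ ^ 2) ((-b) • (2 • innerSL ℝ x)) x :=
    ((hasStrictFDerivAt_norm_sq x).hasFDerivAt).const_mul (-b)
  have h2 := (h1.exp).const_mul A
  change HasFDerivAt (gaussian A b) _ x at h2
  rw [h2.fderiv]
  simp [gaussian]
  ring

theorem fderiv_fderiv_gaussian (A b : ℝ) (x v : E3) :
    fderiv ℝ (fun y => fderiv ℝ (gaussian A b) y v) x v =
      (4 * b ^ 2 * (inner ℝ x v) ^ 2 - 2 * b * ‖v‖ ^ 2) * gaussian A b x := by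
  have h0 : (fun y => fderiv ℝ (gaussian A b) y v) =
      fun y => (-2 * b * inner ℝ y v) * gaussian A b y := by
    ext y
    exact fderiv_gaussian A b y v
  have h1 : HasFDerivAt (fun y : E3 => -2 * b * inner ℝ y v) ((-2 * b) • innerSL ℝ v) x := by
    have h := ((innerSL ℝ v).hasFDerivAt (x := x)).const_mul (-2 * b)
    simpa [real_inner_comm] using h
  have h2 := ((contDiff_gaussian A b (n := 1)).differentiable one_ne_zero x).hasFDerivAt
  have h3 : HasFDerivAt (fun y => (-2 * b * inner ℝ y v) * gaussian A b y) _ x := h1.mul h2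
  rw [h0, h3.fderiv]
  simp [fderiv_gaussian]
  ring

theorem laplacian_eq_sum_fderiv {f : E3 → ℝ} (hf : ContDiff ℝ 2 f) (x : E3) :
    Laplacian.laplacian f x = ∑ i, fderiv ℝ (fun y => fderiv ℝ f y (EuclideanSpace.single i 1)) x
      (EuclideanSpace.single i 1) := by
  rw [InnerProductSpace.laplacian_eq_iteratedFDeriv_orthonormalBasis f
    (EuclideanSpace.basisFun (Fin 3) ℝ)]
  refine Finset.sum_congr rfl fun i _ => ?_
  rw [iteratedFDeriv_two_apply]
  have hd : DifferentiableAt ℝ (fderiv ℝ f) x :=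
    (hf.fderiv_right (m := 1) (by norm_num)).differentiable one_ne_zero x
  rw [fderiv_clm_apply hd (differentiableAt_const _)]
  simp

/-- Integration by parts for second derivatives against test functions. -/
theorem integral_mul_fderiv_fderiv {f φ : E3 → ℝ} (hf : ContDiff ℝ 2 f) (hφ : ContDiff ℝ 2 φ)
    (hc : HasCompactSupport φ) (v : E3) :
    ∫ x, f x * fderiv ℝ (fun y => fderiv ℝ φ y v) x v =
      ∫ x, fderiv ℝ (fun y => fderiv ℝ f y v) x v * φ x := by
  have hf1 : ContDiff ℝ 1 fun y => fderiv ℝ f y v :=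
    (hf.fderiv_right (m := 1) (by norm_num)).clm_apply contDiff_const
  have hφ1 : ContDiff ℝ 1 fun y => fderiv ℝ φ y v :=
    (hφ.fderiv_right (m := 1) (by norm_num)).clm_apply contDiff_const
  have hf2 : Continuous fun x => fderiv ℝ (fun y => fderiv ℝ f y v) x v :=
    (hf1.continuous_fderiv one_ne_zero).clm_apply continuous_const
  have hφ2 : Continuous fun x => fderiv ℝ (fun y => fderiv ℝ φ y v) x v :=
    (hφ1.continuous_fderiv one_ne_zero).clm_apply continuous_const
  have hc1 : HasCompactSupport fun y => fderiv ℝ φ y v := hc.fderiv_apply ℝ v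
  have hc2 : HasCompactSupport fun x => fderiv ℝ (fun y => fderiv ℝ φ y v) x v :=
    hc1.fderiv_apply ℝ v
  have hfd := hf.differentiable two_ne_zero
  have hφd := hφ.differentiable two_ne_zero
  rw [integral_mul_fderiv_eq_neg_fderiv_mul_of_integrable
    ((hf1.continuous.mul hφ1.continuous).integrable_of_hasCompactSupport hc1.mul_left)
    ((hf.continuous.mul hφ2).integrable_of_hasCompactSupport hc2.mul_left)
    ((hf.continuous.mul hφ1.continuous).integrable_of_hasCompactSupport hc1.mul_left)
    (fun x _ => hfd x) (fun x _ => hφ1.differentiable one_ne_zero x),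
    integral_mul_fderiv_eq_neg_fderiv_mul_of_integrable
    ((hf2.mul hφ.continuous).integrable_of_hasCompactSupport hc.mul_left)
    ((hf1.continuous.mul hφ1.continuous).integrable_of_hasCompactSupport hc1.mul_left)
    ((hf1.continuous.mul hφ.continuous).integrable_of_hasCompactSupport hc.mul_left)
    (fun x _ => hf1.differentiable one_ne_zero x) (fun x _ => hφd x), neg_neg]

theorem laplacian_gaussian (A b : ℝ) (x : E3) : Laplacian.laplacian (gaussian A b) x =
    (4 * b ^ 2 * ‖x‖ ^ 2 - 6 * b) * gaussian A b x := by
  rw [laplacian_eq_sum_fderiv (contDiff_gaussian A b)]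
  simp only [fderiv_fderiv_gaussian, ← Finset.sum_mul, Finset.sum_sub_distrib, ← Finset.mul_sum,
    EuclideanSpace.inner_single_right, EuclideanSpace.real_norm_sq_eq x]
  simp [-mul_eq_mul_right_iff]
  ring

theorem continuous_fderiv_fderiv {f : E3 → ℝ} (hf : ContDiff ℝ 2 f) (v : E3) :
    Continuous fun x => fderiv ℝ (fun y => fderiv ℝ f y v) x v :=
  (((hf.fderiv_right (m := 1) (by norm_num)).clm_apply contDiff_const).continuous_fderiv
    one_ne_zero).clm_apply continuous_const

theorem integrable_mul_fderiv_fderiv {f φ : E3 → ℝ} (hf : Continuous f) (hφ : ContDiff ℝ 2 φ)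
    (hc : HasCompactSupport φ) (v : E3) :
    Integrable fun x => f x * fderiv ℝ (fun y => fderiv ℝ φ y v) x v :=
  (hf.mul (continuous_fderiv_fderiv hφ v)).integrable_of_hasCompactSupport
    ((hc.fderiv_apply ℝ v).fderiv_apply ℝ v).mul_left

theorem integrable_mul_laplacian {f φ : E3 → ℝ} (hf : Continuous f) (hφ : ContDiff ℝ 2 φ)
    (hc : HasCompactSupport φ) : Integrable fun x => f x * Laplacian.laplacian φ x := by
  simp only [laplacian_eq_sum_fderiv hφ, Finset.mul_sum]
  exact integrable_finsetSum _ fun i _ => integrable_mul_fderiv_fderiv hf hφ hc _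

theorem integral_mul_laplacian {f φ : E3 → ℝ} (hf : ContDiff ℝ 2 f) (hφ : ContDiff ℝ 2 φ)
    (hc : HasCompactSupport φ) :
    ∫ x, f x * Laplacian.laplacian φ x = ∫ x, Laplacian.laplacian f x * φ x := by
  simp only [laplacian_eq_sum_fderiv hf, laplacian_eq_sum_fderiv hφ, Finset.mul_sum,
    Finset.sum_mul]
  rw [integral_finsetSum, integral_finsetSum]
  · exact Finset.sum_congr rfl fun i _ => integral_mul_fderiv_fderiv hf hφ hc _
  · intro i _
    exact ((continuous_fderiv_fderiv hf _).mul hφ.continuous).integrable_of_hasCompactSupport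
      hc.mul_left
  · intro i _
    exact integrable_mul_fderiv_fderiv hf.continuous hφ hc _

theorem decayCondition_gaussian {A b : ℝ} (hA : 0 ≤ A) (hb : 0 < b) :
    DecayCondition (gaussian A b) := by
  have hcont : Continuous (gaussian A b) := (contDiff_gaussian A b (n := 0)).continuous
  have hbd : ∀ x, ‖(1 + ‖x‖ ^ 2) * gaussian A b x‖ ≤
      ‖gaussian ((1 + (b / 2)⁻¹) * A) (b / 2) x‖ := by
    intro x
    rw [Real.norm_of_nonneg (mul_nonneg (by positivity) (gaussian_nonneg hA b x))]
    exact (one_add_mul_gaussian_le hA hb x).trans (le_abs_self _)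
  have hc1 : Continuous fun x : E3 => (1 + ‖x‖ ^ 2) * gaussian A b x := by fun_prop
  refine ⟨(memLp_gaussian _ (half_pos hb)).of_le hc1.aestronglyMeasurable
    (Eventually.of_forall hbd),
    fun x => (4 * b ^ 2 * ‖x‖ ^ 2 - 6 * b) * gaussian A b x - gaussian A b x, ?_, ?_⟩
  -- Here |4b²|x|² - 6b - 1| ≤ (4b² + 6b + 1)(1 + |x|²), and the last factor is absorbed into a
  -- Gaussian of rate b/2.
  · refine ((integrable_gaussian ((1 + (b / 2)⁻¹) * A) (half_pos hb)).const_mul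
      (4 * b ^ 2 + 6 * b + 1)).mono (by fun_prop) (Eventually.of_forall fun x => ?_)
    rw [norm_mul, Real.norm_of_nonneg (by positivity : 0 ≤ 4 * b ^ 2 + 6 * b + 1)]
    refine le_trans ?_ (mul_le_mul_of_nonneg_left (hbd x) (by positivity))
    rw [← sub_one_mul, norm_mul, norm_mul, ← mul_assoc]
    refine mul_le_mul_of_nonneg_right ?_ (norm_nonneg _)
    rw [Real.norm_eq_abs, Real.norm_of_nonneg (by positivity : 0 ≤ 1 + ‖x‖ ^ 2), abs_le]
    have h1 := sq_nonneg ‖x‖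
    have h2 : 0 ≤ b ^ 2 * ‖x‖ ^ 2 := by positivity
    have h3 : 0 ≤ b * ‖x‖ ^ 2 := by positivity
    have h4 := sq_nonneg b
    constructor <;> nlinarith
  · intro φ hφ hc
    have hφ2 : ContDiff ℝ 2 φ := hφ.of_le (WithTop.coe_le_coe.2 le_top)
    have h := integral_mul_laplacian (contDiff_gaussian A b) hφ2 hc
    simp only [laplacian_gaussian] at h
    simp only [mul_sub (gaussian A b _), sub_mul _ (gaussian A b _) (φ _)]
    have hi : Integrable fun x => gaussian A b x * φ x := (hcont.mul hφ2.continuous).integrable_of_hasCompactSupport hc.mul_left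
    rw [integral_sub (integrable_mul_laplacian hcont hφ2 hc) hi, h, integral_sub ?_ hi]
    exact Continuous.integrable_of_hasCompactSupport (by fun_prop) hc.mul_left

/-- The Gaussian ion density of total charge `Z`, with Fourier transform `Z e^{-|ξ|²/(4b)}`. -/
noncomputable def gaussianIon (Z b : ℝ) : E3 → ℝ :=
  gaussian (Z * ((Real.pi / b) ^ (3 / 2 : ℝ))⁻¹) b

theorem rpow_pi_div_pos {b : ℝ} (hb : 0 < b) : 0 < (Real.pi / b) ^ (3 / 2 : ℝ) :=
  Real.rpow_pos_of_pos (div_pos Real.pi_pos hb) _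

theorem fourierT_gaussianIon (Z : ℝ) {b : ℝ} (hb : 0 < b) (ξ : E3) :
    fourierT (gaussianIon Z b) ξ = ((Z * Real.exp (-(4 * b)⁻¹ * ‖ξ‖ ^ 2) : ℝ) : ℂ) := by
  rw [gaussianIon, fourierT_gaussian _ hb, inv_mul_cancel_right₀ (rpow_pi_div_pos hb).ne']

theorem norm_fourierT_gaussianIon_sq (Z : ℝ) {b : ℝ} (hb : 0 < b) (ξ : E3) :
    ‖fourierT (gaussianIon Z b) ξ‖ ^ 2 = Z ^ 2 * Real.exp (-(2 * b)⁻¹ * ‖ξ‖ ^ 2) := by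
  rw [fourierT_gaussianIon Z hb, Complex.norm_real, Real.norm_eq_abs, sq_abs, mul_pow,
    ← Real.exp_nat_mul]
  congr 2
  field_simp
  ring

theorem gaussianIon_coeff_nonneg {Z b : ℝ} (hZ : 0 < Z) (hb : 0 < b) :
    0 ≤ Z * ((Real.pi / b) ^ (3 / 2 : ℝ))⁻¹ :=
  mul_nonneg hZ.le (inv_nonneg.2 (rpow_pi_div_pos hb).le)

theorem isIonDensity_gaussianIon {Z b : ℝ} (hZ : 0 < Z) (hb : 0 < b) :
    IsIonDensity Z (gaussianIon Z b) where
  memLp := memLp_gaussian _ hb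
  integrable := integrable_gaussian _ hb
  integral_eq := by
    rw [gaussianIon, integral_gaussian _ hb, inv_mul_cancel_right₀ (rpow_pi_div_pos hb).ne']
  periodization_memLp := memLp_periodization_gaussian (gaussianIon_coeff_nonneg hZ hb) hb

theorem decayCondition_gaussianIon {Z b e : ℝ} (hZ : 0 < Z) (hb : 0 < b) (he : 0 < e) :
    DecayCondition fun x => e * gaussianIon Z b x := by
  have : (fun x => e * gaussianIon Z b x) =
      gaussian (e * (Z * ((Real.pi / b) ^ (3 / 2 : ℝ))⁻¹)) b := by
    ext x
    simp only [gaussianIon, gaussian]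
    ring
  rw [this]
  exact decayCondition_gaussian (mul_nonneg he.le (gaussianIon_coeff_nonneg hZ hb)) hb

/-! ### The lattice sum Σ(θ) for Gaussians -/

theorem exp_neg_mul_norm_dualPt_sub_sq_le {c : ℝ} (hc : 0 < c) (m : Fin 3 → ℤ) (θ : E3) :
    Real.exp (-c * ‖dualPt m - θ‖ ^ 2) ≤
      Real.exp (c * ‖θ‖ ^ 2) * Real.exp (-(c / 2) * ‖dualPt m‖ ^ 2) := by
  rw [← Real.exp_add, Real.exp_le_exp]
  nlinarith [half_norm_sq_sub_le (dualPt m) θ]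

theorem summable_exp_neg_mul_norm_dualPt_sub_sq {c : ℝ} (hc : 0 < c) (θ : E3) :
    Summable fun m => Real.exp (-c * ‖dualPt m - θ‖ ^ 2) :=
  Summable.of_nonneg_of_le (fun _ => (Real.exp_pos _).le)
    (fun m => exp_neg_mul_norm_dualPt_sub_sq_le hc m θ)
    ((summable_exp_neg_mul_norm_dualPt_sq (half_pos hc)).mul_left _)

theorem abs_mul_div_norm_sq_le (v : E3) (i j : Fin 3) : |v i * v j / ‖v‖ ^ 2| ≤ 1 := by
  rw [abs_div, abs_mul, abs_of_nonneg (sq_nonneg ‖v‖)]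
  refine div_le_one_of_le₀ ?_ (sq_nonneg _)
  rw [sq]
  exact mul_le_mul (PiLp.norm_apply_le v i) (PiLp.norm_apply_le v j) (abs_nonneg _) (norm_nonneg _)

/-- The terms of the lattice sum `Σ(θ)` for the Gaussian density. -/
noncomputable def wienerTerm (Z b : ℝ) (i j : Fin 3) (ξ : E3) : ℝ :=
  ξ i * ξ j / ‖ξ‖ ^ 2 * (Z ^ 2 * Real.exp (-(2 * b)⁻¹ * ‖ξ‖ ^ 2))

theorem abs_wienerTerm_le (Z b : ℝ) (i j : Fin 3) (ξ : E3) :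
    |wienerTerm Z b i j ξ| ≤ Z ^ 2 * Real.exp (-(2 * b)⁻¹ * ‖ξ‖ ^ 2) := by
  rw [wienerTerm, abs_mul, abs_of_nonneg (by positivity : 0 ≤ Z ^ 2 * Real.exp _)]
  exact mul_le_of_le_one_left (by positivity) (abs_mul_div_norm_sq_le ξ i j)

theorem summable_wienerTerm (Z : ℝ) {b : ℝ} (hb : 0 < b) (i j : Fin 3) (θ : E3) :
    Summable fun m => wienerTerm Z b i j (dualPt m - θ) :=
  Summable.of_norm_bounded ((summable_exp_neg_mul_norm_dualPt_sub_sq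
    (by positivity : 0 < (2 * b)⁻¹) θ).mul_left (Z ^ 2)) fun _ => abs_wienerTerm_le Z b i j _

theorem wienerMatrix_gaussianIon (Z : ℝ) {b : ℝ} (hb : 0 < b) (θ : E3) (i j : Fin 3) :
    wienerMatrix (gaussianIon Z b) θ i j = ∑' m, wienerTerm Z b i j (dualPt m - θ) := by
  simp only [wienerMatrix, Matrix.of_apply, norm_fourierT_gaussianIon_sq Z hb, wienerTerm]

theorem wienerMatrix_const_mul (e : ℝ) (σ : E3 → ℝ) (θ : E3) :
    wienerMatrix (fun x => e * σ x) θ = e ^ 2 • wienerMatrix σ θ := by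
  ext i j
  simp only [wienerMatrix, Matrix.of_apply, Matrix.smul_apply, fourierT_const_mul, smul_eq_mul,
    ← tsum_mul_left, norm_mul, mul_pow, Complex.norm_real, Real.norm_eq_abs, sq_abs]
  exact tsum_congr fun m => by ring

theorem hasSum_wienerMatrix_form (Z : ℝ) {b : ℝ} (hb : 0 < b) (θ : E3) (v : Fin 3 → ℝ) :
    HasSum (fun m => (∑ i, v i * (dualPt m - θ) i) ^ 2 / ‖dualPt m - θ‖ ^ 2 *
        (Z ^ 2 * Real.exp (-(2 * b)⁻¹ * ‖dualPt m - θ‖ ^ 2)))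
      (∑ i, v i * ∑ j, wienerMatrix (gaussianIon Z b) θ i j * v j) := by
  have h := hasSum_sum (s := Finset.univ) fun i _ =>
    (hasSum_sum (s := Finset.univ) fun j _ =>
      ((summable_wienerTerm Z hb i j θ).hasSum.mul_right (v j))).mul_left (v i)
  simp only [← wienerMatrix_gaussianIon Z hb] at h
  refine h.congr_fun fun m => ?_
  simp only [Fin.sum_univ_three, wienerTerm]
  ring

theorem posDef_wienerMatrix_gaussianIon {Z b : ℝ} (hZ : 0 < Z) (hb : 0 < b) {θ : E3}
    (hθ : θ ∉ dualLattice) : (wienerMatrix (gaussianIon Z b) θ).PosDef := by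
  refine Matrix.PosDef.of_dotProduct_mulVec_pos ?_ fun v hv => ?_
  · ext i j
    simp only [Matrix.conjTranspose_apply, wienerMatrix, Matrix.of_apply, star_trivial]
    exact tsum_congr fun m => by ring
  · have h := hasSum_wienerMatrix_form Z hb θ v
    have e : star v ⬝ᵥ (wienerMatrix (gaussianIon Z b) θ).mulVec v =
        ∑ i, v i * ∑ j, wienerMatrix (gaussianIon Z b) θ i j * v j := by
      simp [dotProduct, Matrix.mulVec]
    rw [e]
    have hne : ∀ m, dualPt m - θ ≠ 0 := fun m hm => hθ ⟨m, sub_eq_zero.1 hm⟩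
    have hnn : ∀ m, 0 ≤ (∑ i, v i * (dualPt m - θ) i) ^ 2 / ‖dualPt m - θ‖ ^ 2 *
        (Z ^ 2 * Real.exp (-(2 * b)⁻¹ * ‖dualPt m - θ‖ ^ 2)) := fun m => by positivity
    -- A vector orthogonal to all 2πm - θ is orthogonal to their differences, in particular to 2π
    -- times each unit vector.
    have hex : ∃ m, ∑ i, v i * (dualPt m - θ) i ≠ 0 := by
      by_contra! hall
      apply hv
      ext i
      have h0 := hall 0
      have h1 := hall (Pi.single i 1)
      have h2 : ∑ j, v j * (dualPt (Pi.single i 1)) j = 0 := by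
        have : ∀ j, v j * (dualPt (Pi.single i 1)) j = v j * (dualPt (Pi.single i 1) - θ) j -
            v j * (dualPt 0 - θ) j := fun j => by simp; ring
        simp only [this, Finset.sum_sub_distrib, h0, h1, sub_zero]
      rw [Finset.sum_eq_single i (fun j _ hj => by simp [dualPt, hj]) (by simp)] at h2
      simpa [dualPt] using h2
    obtain ⟨m, hm⟩ := hex
    refine lt_of_lt_of_le ?_ (le_hasSum h m fun k _ => hnn k)
    have h1 : 0 < ‖dualPt m - θ‖ := norm_pos_iff.2 (hne m)
    positivity

theorem wienerCondition_gaussianIon {Z b e : ℝ} (hZ : 0 < Z) (hb : 0 < b) (he : 0 < e) :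
    WienerCondition fun x => e * gaussianIon Z b x := by
  refine Eventually.of_forall fun θ hθ => ?_
  rw [wienerMatrix_const_mul]
  exact (posDef_wienerMatrix_gaussianIon hZ hb hθ.2).smul (by positivity)

/-- The lattice sum `Σ(θ)` is continuous away from the dual lattice. -/
theorem continuousAt_wienerMatrix_gaussianIon (Z : ℝ) {b : ℝ} (hb : 0 < b) (i j : Fin 3) {θ : E3}
    (hθ : θ ∉ dualLattice) : ContinuousAt (fun θ => wienerMatrix (gaussianIon Z b) θ i j) θ := by
  simp only [wienerMatrix_gaussianIon Z hb]
  have hc : 0 < (2 * b)⁻¹ := by positivity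
  refine tendsto_tsum_of_dominated_convergence
    -- Uniform for shifts in the unit ball around θ, hence the radius ‖θ‖ + 1.
    (bound := fun m => Z ^ 2 * (Real.exp ((2 * b)⁻¹ * (‖θ‖ + 1) ^ 2) *
      Real.exp (-((2 * b)⁻¹ / 2) * ‖dualPt m‖ ^ 2)))
    (((summable_exp_neg_mul_norm_dualPt_sq (half_pos hc)).mul_left _).mul_left _) (fun m => ?_) ?_
  · have hne : ‖dualPt m - θ‖ ^ 2 ≠ 0 :=
      pow_ne_zero 2 (norm_ne_zero_iff.2 fun hm => hθ ⟨m, sub_eq_zero.1 hm⟩)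
    have : ContinuousAt (fun θ => wienerTerm Z b i j (dualPt m - θ)) θ := by
      unfold wienerTerm
      refine ContinuousAt.mul (ContinuousAt.div ?_ ?_ hne) ?_ <;> fun_prop
    exact this
  · filter_upwards [Metric.ball_mem_nhds θ one_pos] with η hη m
    refine (abs_wienerTerm_le Z b i j _).trans (mul_le_mul_of_nonneg_left ?_ (sq_nonneg Z))
    refine (exp_neg_mul_norm_dualPt_sub_sq_le hc m η).trans
      (mul_le_mul_of_nonneg_right (Real.exp_le_exp.2 ?_) (Real.exp_pos _).le)
    have : ‖η‖ ≤ ‖θ‖ + 1 := by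
      have h1 := norm_sub_norm_le η θ
      have h2 := mem_ball_iff_norm.1 hη
      linarith
    gcongr

/-! ### The lattice sum at the point (0, π, π) -/

/-- The point `(0, π, π)` of the Brillouin zone. -/
noncomputable def edgePt : E3 := WithLp.toLp 2 ![0, Real.pi, Real.pi]

/-- The last two coordinates of 2πm - (0, π, π) are odd multiples of π. -/
theorem sq_pi_le_dualPt_sub_edgePt (m : Fin 3 → ℤ) :
    Real.pi ^ 2 ≤ (dualPt m - edgePt) 1 ^ 2 ∧ Real.pi ^ 2 ≤ (dualPt m - edgePt) 2 ^ 2 := by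
  have key : ∀ k : ℤ, Real.pi ^ 2 ≤ (2 * Real.pi * k - Real.pi) ^ 2 := by
    intro k
    have h1 : (1 : ℝ) ≤ (2 * k - 1) ^ 2 := by
      have : (1 : ℤ) ≤ (2 * k - 1) ^ 2 := by
        have h : (2 * k - 1) ≠ 0 := by omega
        have := sq_pos_of_ne_zero h
        omega
      exact_mod_cast this
    have e : (2 * Real.pi * k - Real.pi) ^ 2 = Real.pi ^ 2 * (2 * k - 1) ^ 2 := by ring
    rw [e]
    exact le_mul_of_one_le_right (sq_nonneg _) h1
  constructor <;> simpa [dualPt, edgePt] using key _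

theorem edgePt_notMem_dualLattice : edgePt ∉ dualLattice := by
  rintro ⟨m, hm⟩
  have := (sq_pi_le_dualPt_sub_edgePt m).1
  rw [hm] at this
  simp at this

/-- At `(0, π, π)` the lattice sum is much smaller than its contribution from the points
`(±2π, 0, 0)` at `θ = 0`, if the Gaussian is wide. -/
theorem exists_wienerMatrix_edgePt_lt {Z : ℝ} (hZ : 0 < Z) : ∃ b : ℝ, 0 < b ∧
    wienerMatrix (gaussianIon Z b) edgePt 0 0 <
      Z ^ 2 * Real.exp (-(2 * b)⁻¹ * (2 * Real.pi) ^ 2) := by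
  set C := ∑' m, Real.exp (-1 * ‖dualPt m - edgePt‖ ^ 2) with hC
  have hs1 := summable_exp_neg_mul_norm_dualPt_sub_sq one_pos edgePt
  -- With c = (2b)⁻¹, one factor e^{-|ξ|²} is kept for summability and |ξ|² ≥ 6π² is used in the
  -- remaining e^{-(c-1)|ξ|²}. Against e^{-4π²c} this leaves the decay e^{-2π²c}.
  have hlim : Tendsto (fun c : ℝ => C * Real.exp (6 * Real.pi ^ 2) *
      Real.exp (-(2 * Real.pi ^ 2 * c))) atTop (𝓝 0) := by
    have h1 : Tendsto (fun c : ℝ => 2 * Real.pi ^ 2 * c) atTop atTop :=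
      tendsto_id.const_mul_atTop (by positivity)
    simpa using (Real.tendsto_exp_neg_atTop_nhds_zero.comp h1).const_mul
      (C * Real.exp (6 * Real.pi ^ 2))
  obtain ⟨c, hc1, hc⟩ := ((hlim.eventually (gt_mem_nhds one_pos)).and
    (eventually_ge_atTop 1)).exists
  have hc0 : 0 < c := by linarith
  have hb : 0 < (2 * c)⁻¹ := by positivity
  have hbc : (2 * (2 * c)⁻¹)⁻¹ = c := by field_simp
  refine ⟨(2 * c)⁻¹, hb, ?_⟩
  rw [wienerMatrix_gaussianIon Z hb, hbc]
  have hle : ∀ m, wienerTerm Z (2 * c)⁻¹ 0 0 (dualPt m - edgePt) ≤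
      Z ^ 2 * Real.exp (-(c - 1) * (6 * Real.pi ^ 2)) *
        Real.exp (-1 * ‖dualPt m - edgePt‖ ^ 2) := by
    intro m
    -- The choice of a vanishing first coordinate pays off here: the nearest shifted points have ξ₁
    -- = 0 and drop out of this entry.
    by_cases hm : m 0 = 0
    · have h0 : (dualPt m - edgePt) 0 = 0 := by simp [dualPt, edgePt, hm]
      rw [wienerTerm, h0]
      simp only [mul_zero, zero_div, zero_mul]
      positivity
    · refine (le_abs_self _).trans ((abs_wienerTerm_le _ _ _ _ _).trans ?_)
      rw [hbc, mul_assoc, ← Real.exp_add]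
      refine mul_le_mul_of_nonneg_left (Real.exp_le_exp.2 ?_) (sq_nonneg Z)
      have h6 : 6 * Real.pi ^ 2 ≤ ‖dualPt m - edgePt‖ ^ 2 := by
        rw [EuclideanSpace.real_norm_sq_eq, Fin.sum_univ_three]
        obtain ⟨h1, h2⟩ := sq_pi_le_dualPt_sub_edgePt m
        have h3 : 4 * Real.pi ^ 2 ≤ (dualPt m - edgePt) 0 ^ 2 := by
          have h4 : (1 : ℝ) ≤ (m 0 : ℝ) ^ 2 := by
            have : (1 : ℤ) ≤ (m 0) ^ 2 := by
              have := sq_pos_of_ne_zero hm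
              omega
            exact_mod_cast this
          have e : (dualPt m - edgePt) 0 ^ 2 = 4 * Real.pi ^ 2 * (m 0 : ℝ) ^ 2 := by
            simp [dualPt, edgePt]
            ring
          rw [e]
          exact le_mul_of_one_le_right (by positivity) h4
        linarith
      nlinarith
  have h := (summable_wienerTerm Z hb 0 0 edgePt).tsum_le_tsum hle (hs1.mul_left _)
  refine h.trans_lt ?_
  rw [tsum_mul_left, ← hC, mul_assoc]
  refine mul_lt_mul_of_pos_left ?_ (by positivity)
  have e1 : Real.exp (-(c - 1) * (6 * Real.pi ^ 2)) * C =
      (C * Real.exp (6 * Real.pi ^ 2) * Real.exp (-(2 * Real.pi ^ 2 * c))) *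
        Real.exp (-c * (2 * Real.pi) ^ 2) := by
    rw [mul_assoc, mul_assoc, ← Real.exp_add, ← Real.exp_add, mul_comm]
    congr 2
    ring
  rw [e1]
  exact mul_lt_of_lt_one_left (Real.exp_pos _) hc1

/-! ### Failure of energy positivity -/

/-- States without electronic component and momentum have the energy `Q · T̂(θ) Q`. -/
theorem blochEnergy_single (M e : ℝ) (σ : E3 → ℝ) (ψ : T3 → ℝ) (ω : ℝ) (θ : E3) (i : Fin 3) :
    blochEnergy M e σ ψ ω θ ⟨fun _ => 0, fun _ => 0, EuclideanSpace.single i 1, 0⟩ =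
      matrixT e σ ψ θ i i := by
  have h0 : coeff (fun _ => 0) = fun _ => 0 := coeff_zero_fun
  have hsum : ∑ k, ∑ j, star ((EuclideanSpace.single i (1 : ℂ)) k) * (matrixT e σ ψ θ k j : ℂ) *
      (EuclideanSpace.single i (1 : ℂ)) j = (matrixT e σ ψ θ i i : ℂ) := by
    rw [Finset.sum_eq_single i, Finset.sum_eq_single i]
    · simp
    · intro j _ hj
      simp [hj]
    · simp
    · intro j _ hj
      simp [hj]
    · simp
  simp only [blochEnergy, schrodingerForm, greenForm, mul_zero, h0, hsum]
  simp

theorem normVSq_single (i : Fin 3) :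
    State.normVSq ⟨fun _ => 0, fun _ => 0, EuclideanSpace.single i 1, 0⟩ = 1 := by
  have h0 : coeff (fun _ => 0) = fun _ => 0 := coeff_zero_fun
  simp [State.normVSq, normH1Sq, h0]

theorem memV_single (i : Fin 3) :
    State.MemV ⟨fun _ => 0, fun _ => 0, EuclideanSpace.single i 1, 0⟩ := by
  have h0 : coeff (fun _ => 0) = fun _ => 0 := coeff_zero_fun
  have : MemH1 fun _ => 0 := ⟨MemLp.zero, by simp only [h0]; simp⟩
  exact ⟨this, this⟩

/-- Energy positivity fails if a diagonal entry of `T̂(θ)` is negative on an open set. -/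
theorem not_energyPositivity {M e : ℝ} {σ : E3 → ℝ} {ψ : T3 → ℝ} {ω : ℝ} {U : Set E3} {i : Fin 3}
    (hU : IsOpen U) (hne : U.Nonempty) (hsub : U ⊆ brillouinZone \ dualLattice)
    (hneg : ∀ θ ∈ U, matrixT e σ ψ θ i i < 0) : ¬ EnergyPositivity M e σ ψ ω := by
  intro h
  obtain ⟨θ, hθ, hθU⟩ :=
    -- A nonempty open set has positive measure, so it meets the full-measure set on which
    -- positivity is assumed.
    (h.and_frequently (frequently_ae_mem_iff.2 (hU.measure_pos volume hne).ne')).exists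
  obtain ⟨κ, hκ, hκ'⟩ := hθ (hsub hθU)
  have := hκ' _ (memV_single i)
  rw [normVSq_single, blochEnergy_single] at this
  linarith [hneg θ hθU]

/-- The points of the open Brillouin zone near `(0, π, π)`. -/
theorem exists_open_near_edgePt {V : Set E3} (hV : V ∈ 𝓝 edgePt) : ∃ U : Set E3, IsOpen U ∧
    U.Nonempty ∧ U ⊆ V ∧ U ⊆ brillouinZone \ dualLattice := by
  obtain ⟨W, hWV, hW, hWm⟩ := mem_nhds_iff.1 hV
  let B : Set E3 := {θ | ∀ i, 0 < θ i ∧ θ i < 2 * Real.pi}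
  have hB : IsOpen B := by
    have h : B = ⋂ i, (fun θ : E3 => θ i) ⁻¹' Set.Ioo 0 (2 * Real.pi) := by
      ext θ
      simp [B]
    rw [h]
    exact isOpen_iInter_of_finite fun i =>
      isOpen_Ioo.preimage (EuclideanSpace.proj (𝕜 := ℝ) i).continuous
  refine ⟨W ∩ B, hW.inter hB, ?_, fun θ hθ => hWV hθ.1, fun θ hθ =>
    ⟨fun i => ⟨(hθ.2 i).1.le, (hθ.2 i).2.le⟩, ?_⟩⟩
  -- The point (0, π, π) lies on the boundary of the zone; a small step along the first axis leads
  -- into the interior.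
  · have hc : ContinuousAt (fun s : ℝ => edgePt + s • EuclideanSpace.single (0 : Fin 3) (1 : ℝ)) 0 :=
      by fun_prop
    have h1 : ∀ᶠ s in 𝓝[>] (0 : ℝ), edgePt + s • EuclideanSpace.single (0 : Fin 3) (1 : ℝ) ∈ W :=
      nhdsWithin_le_nhds (hc (by simpa using hW.mem_nhds hWm))
    have h2 : ∀ᶠ s in 𝓝[>] (0 : ℝ), s < Real.pi :=
      nhdsWithin_le_nhds (gt_mem_nhds Real.pi_pos)
    obtain ⟨s, ⟨hs1, hs2⟩, hs3⟩ := ((h1.and h2).and self_mem_nhdsWithin).exists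
    have hs0 : 0 < s := hs3
    have := Real.pi_pos
    refine ⟨_, hs1, fun i => ?_⟩
    fin_cases i <;> simp [edgePt] <;> constructor <;> linarith
  · rintro ⟨m, rfl⟩
    have h := hθ.2 0
    have hp := Real.pi_pos
    simp only [dualPt] at h
    have h1 : (0 : ℝ) < m 0 := by
      by_contra hn
      nlinarith [h.1]
    have h2 : (m 0 : ℝ) < 1 := by
      by_contra hn
      nlinarith [h.2]
    have h3 : 0 < m 0 := by exact_mod_cast h1
    have h4 : m 0 < 1 := by exact_mod_cast h2
    omega

/-- For wide Gaussian ion densities energy positivity fails. -/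
theorem exists_gaussianIon_not_energyPositivity {Z : ℝ} (hZ : 0 < Z) (M : ℝ) : ∃ b : ℝ, 0 < b ∧
    ∃ e₀ : ℝ, 0 < e₀ ∧ ∀ e : ℝ, 0 < e → e < e₀ → ∀ (ψ : T3 → ℝ) (ω : ℝ),
      IsRealGroundState Z e (fun x => e * gaussianIon Z b x) ψ ω →
        ¬ EnergyPositivity M e (fun x => e * gaussianIon Z b x) ψ ω := by
  obtain ⟨b, hb, hlt⟩ := exists_wienerMatrix_edgePt_lt hZ
  set L := Z ^ 2 * Real.exp (-(2 * b)⁻¹ * (2 * Real.pi) ^ 2) with hL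
  -- With error L - r, the entry of T̂₂ is at most -e²r, while near (0, π, π) that of T̂₁ stays
  -- below e²r.
  obtain ⟨r, hr1, hr2⟩ := exists_between hlt
  have hμ := isIonDensity_gaussianIon hZ hb
  obtain ⟨e₀, he₀, h⟩ := exists_matrixT2_form_le hZ hμ (EuclideanSpace.single (0 : Fin 3) (1 : ℝ))
    (sub_pos.2 hr2)
  refine ⟨b, hb, e₀, he₀, fun e he he' ψ ω hgs => ?_⟩
  obtain ⟨U, hU, hne, hUV, hUB⟩ := exists_open_near_edgePt
    ((continuousAt_wienerMatrix_gaussianIon Z hb 0 0 edgePt_notMem_dualLattice).eventually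
      (gt_mem_nhds hr1))
  refine not_energyPositivity (i := 0) hU hne hUB fun θ hθ => ?_
  have hθ' : wienerMatrix (gaussianIon Z b) θ 0 0 < r := hUV hθ
  have hT := h e he he' ψ ω hgs
  have hS : L ≤ ∑' m, (inner ℝ (EuclideanSpace.single (0 : Fin 3) (1 : ℝ)) (dualPt m)) ^ 2 /
      ‖dualPt m‖ ^ 2 * ‖fourierT (gaussianIon Z b) (dualPt m)‖ ^ 2 := by
    have hs := Summable.of_nonneg_of_le (fun m => by positivity)
      (fun m => mul_le_mul_of_nonneg_right
        (inner_sq_div_le (EuclideanSpace.single (0 : Fin 3) (1 : ℝ)) (dualPt m)) (sq_nonneg _))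
      ((summable_norm_fourierT_sq hμ).mul_left _)
    -- The lattice point (2π, 0, 0) alone contributes exactly L.
    refine le_trans (le_of_eq ?_) (hs.le_tsum (Pi.single 0 1) fun k _ => by positivity)
    have h1 : ‖dualPt (Pi.single 0 1)‖ ^ 2 = (2 * Real.pi) ^ 2 := by
      rw [norm_dualPt_sq, Finset.sum_eq_single 0 (fun j _ hj => by simp [hj]) (by simp)]
      simp
    have h2 : inner ℝ (EuclideanSpace.single (0 : Fin 3) (1 : ℝ)) (dualPt (Pi.single 0 1)) =
        2 * Real.pi := by
      simp [EuclideanSpace.inner_single_left, dualPt]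
    rw [norm_fourierT_gaussianIon_sq Z hb, h1, h2, div_self (by positivity), one_mul]
  have hform : ∑ i, ∑ j, (EuclideanSpace.single (0 : Fin 3) (1 : ℝ)) i *
      matrixT2 e (fun x => e * gaussianIon Z b x) ψ i j *
        (EuclideanSpace.single (0 : Fin 3) (1 : ℝ)) j =
      matrixT2 e (fun x => e * gaussianIon Z b x) ψ 0 0 := by
    simp
  rw [hform] at hT
  rw [matrixT, wienerMatrix_const_mul, Matrix.add_apply, Matrix.smul_apply, smul_eq_mul]
  have he2 : 0 < e ^ 2 := by positivity
  nlinarith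

end Crystal

theorem lemma10p1 (Z M : ℝ) (hZ : 0 < Z) (hM : 0 < M) :
    (∃ μ : Crystal.E3 → ℝ, Crystal.IsIonDensity Z μ ∧
      (∃ m : Fin 3 → ℤ, m ≠ 0 ∧ Crystal.fourierT μ (Crystal.dualPt m) ≠ 0) ∧
      ∃ e₀ : ℝ, 0 < e₀ ∧ ∀ e : ℝ, 0 < e → e < e₀ →
        Crystal.DecayCondition (fun x => e * μ x) ∧
        Crystal.WienerCondition (fun x => e * μ x) ∧
        (∃ (ψ : Crystal.T3 → ℝ) (ω : ℝ),
          Crystal.IsRealGroundState Z e (fun x => e * μ x) ψ ω) ∧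
        ∀ (ψ : Crystal.T3 → ℝ) (ω : ℝ),
          Crystal.IsRealGroundState Z e (fun x => e * μ x) ψ ω →
            ¬ Crystal.EnergyPositivity M e (fun x => e * μ x) ψ ω) ∧
    (∀ μ : Crystal.E3 → ℝ, Crystal.IsIonDensity Z μ → Crystal.DecayCondition μ →
      ∀ m : Fin 3 → ℤ, m ≠ 0 → Crystal.fourierT μ (Crystal.dualPt m) ≠ 0 →
        ∃ e₀ : ℝ, 0 < e₀ ∧ ∀ e : ℝ, 0 < e → e < e₀ →
          ∀ (ψ : Crystal.T3 → ℝ) (ω : ℝ),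
            Crystal.IsRealGroundState Z e (fun x => e * μ x) ψ ω →
              ∑ i, ∑ j, Crystal.dualPt m i *
                Crystal.matrixT2 e (fun x => e * μ x) ψ i j * Crystal.dualPt m j < 0) := by
  refine ⟨?_, fun μ hμ _ m hm hmμ => Crystal.exists_matrixT2_form_neg hZ hμ hm hmμ⟩
  obtain ⟨b, hb, e₀, he₀, h⟩ := Crystal.exists_gaussianIon_not_energyPositivity hZ M
  have hμ := Crystal.isIonDensity_gaussianIon hZ hb
  -- Here `1` is m = (1, 1, 1); the Fourier transform of a Gaussian has no zeros.
  refine ⟨Crystal.gaussianIon Z b, hμ, ⟨1, one_ne_zero, ?_⟩, e₀, he₀, fun e he he' =>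
    ⟨Crystal.decayCondition_gaussianIon hZ hb he, Crystal.wienerCondition_gaussianIon hZ hb he,
      Crystal.exists_isRealGroundState hZ hμ e, h e he he'⟩⟩
  rw [Crystal.fourierT_gaussianIon Z hb]
  exact Complex.ofReal_ne_zero.2 (mul_pos hZ (Real.exp_pos _)).ne'
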